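/- Let $\lambda>0$ and $s\in\mathbb R$, and put $A(x)=\sqrt{\lambda}\,\mathrm{Ai}(x)$, where $\mathrm{Ai}$ is the Airy function. Let $K$ be the integral operator on $L^2(s,\infty)$ (complex-valued functions) with the Airy kernel $$K(x,y)=\frac{A(x)A'(y)-A'(x)A(y)}{x-y}\quad(x\ne y),\qquad K(x,x)=A'(x)^2-A(x)A''(x),$$ and let $L$ be the differential operator $$Lf(x)=\big((x-s)f'(x)\big)'-x(x-s)f(x)$$ on $(s,\infty)$. An eigenfunction of $L$ with eigenvalue $\nu\in\mathbb C$ is a not identically zero $C^2$ function $f\in L^2(s,\infty)$ on $(s,\infty)$ with $Lf=\nu f$ on $(s,\infty)$ and $(x-s)f'(x)\to0$ as $x\downarrow s$ (that is, $f$ is regular at the end point $s$). If $f_1$ and $f_2$ are eigenfunctions of $L$ corresponding to distinct eigenvalues, then they are eigenfunctions of $K$ corresponding to distinct eigenvalues. Moreover, every eigenvalue of $K$ is simple, i.e. its eigenspace in $L^2(s,\infty)$ is one-dimensional. -/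

import Mathlib

open MeasureTheory Set Filter Topology

noncomputable section

/-- The Airy function `Ai`, by its (absolutely convergent) contour integral
`Ai x = (2π)⁻¹ ∫ exp (i (ζ ^ 3 / 3 + x ζ)) dζ` along the horizontal line `ζ = t + i`, `t ∈ ℝ`.
The integral is real, and `Complex.re` only changes its type. -/
def airyAi (x : ℝ) : ℝ :=
  (1 / (2 * Real.pi)) *
    (∫ t : ℝ, Complex.exp (Complex.I *
      (((t : ℂ) + Complex.I) ^ 3 / 3 + (x : ℂ) * ((t : ℂ) + Complex.I)))).re

/-- `A = √lam · Ai`. -/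
def airyA (lam x : ℝ) : ℝ := Real.sqrt lam * airyAi x

/-- The Airy kernel `(A x A' y - A' x A y) / (x - y)`, with its limit
`A' x ^ 2 - A x A'' x` on the diagonal. -/
def airyKernel (lam x y : ℝ) : ℝ :=
  if x = y then
    deriv (airyA lam) x ^ 2 - airyA lam x * deriv (deriv (airyA lam)) x
  else
    (airyA lam x * deriv (airyA lam) y - deriv (airyA lam) x * airyA lam y) / (x - y)

/-- `f` is an eigenfunction, with eigenvalue `κ`, of the integral operator `K` on `L²(s, ∞)`
whose kernel is the Airy kernel. -/
structure IsAiryEigenfunction (lam s : ℝ) (f : ℝ → ℂ) (κ : ℂ) : Prop where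
  memLp : MemLp f 2 (volume.restrict (Ioi s))
  ne_zero : ¬ f =ᵐ[volume.restrict (Ioi s)] 0
  integrable : ∀ᵐ x ∂(volume.restrict (Ioi s)),
    IntegrableOn (fun y => (airyKernel lam x y : ℂ) * f y) (Ioi s)
  eigen : ∀ᵐ x ∂(volume.restrict (Ioi s)),
    ∫ y in Ioi s, (airyKernel lam x y : ℂ) * f y = κ * f x

/-- `κ` is an eigenvalue of `K` on `L²(s, ∞)`. -/
def IsAiryEigenvalue (lam s : ℝ) (κ : ℂ) : Prop :=
  ∃ f : ℝ → ℂ, IsAiryEigenfunction lam s f κ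

/-- `κ` is a simple eigenvalue of (the symmetric operator) `K` on `L²(s, ∞)`: the eigenspace in
`L²(s, ∞)` is spanned by one eigenfunction. -/
def IsSimpleAiryEigenvalue (lam s : ℝ) (κ : ℂ) : Prop :=
  ∃ f : ℝ → ℂ, IsAiryEigenfunction lam s f κ ∧
    ∀ g : ℝ → ℂ, IsAiryEigenfunction lam s g κ →
      ∃ c : ℂ, g =ᵐ[volume.restrict (Ioi s)] fun x => c * f x

/-- The differential expression `L f (x) = ((x - s) f' x)' - x (x - s) f x`. -/
def diffL (s : ℝ) (f : ℝ → ℂ) (x : ℝ) : ℂ :=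
  deriv (fun y : ℝ => ((y - s : ℝ) : ℂ) * deriv f y) x - ((x * (x - s) : ℝ) : ℂ) * f x

/-- `f` is an eigenfunction, with eigenvalue `ν`, of the self-adjoint operator that `diffL s`
defines in `L²(s, ∞)`. The end point `s` is singular (limit circle), and the boundary condition
`(x - s) f' x → 0` selects the solutions that are regular at `s`; at `∞` square integrability is
the only condition (limit point). -/
structure IsDiffLEigenfunction (s : ℝ) (f : ℝ → ℂ) (ν : ℂ) : Prop where
  contDiffOn : ContDiffOn ℝ 2 f (Ioi s)
  memLp : MemLp f 2 (volume.restrict (Ioi s))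
  boundary : Tendsto (fun x : ℝ => ((x - s : ℝ) : ℂ) * deriv f x) (𝓝[>] s) (𝓝 0)
  ne_zero : ∃ x ∈ Ioi s, f x ≠ 0
  eigen : ∀ x ∈ Ioi s, diffL s f x = ν * f x

end

/-! Let `H` be the Hankel operator on (s, ∞) with kernel A(x + y - s). The Airy equation A''(w) = w
A(w) gives two facts: K = H² (`integral_airyDer_mul_airyDer`), and L applied in x to A(x + y - s) is
(x - s)(y - s)A + A', symmetric in x and y. So H commutes with L whenever the boundary terms vanish
(`airyHankel_diff_comm`).

Let Lf = νf with f regular at s. Then Hf solves the same equation and is smooth at s, so the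
Wronskian weighted by x - s is constant and tends to 0 at s. Hence Hf = cf and Kf = c²f.

For simplicity, H is injective, so an eigenvalue of K is μ² with μ ≠ 0, and the eigenspaces of H for
μ and -μ have to be controlled. Differentiating Hf = μf and integrating by parts gives Hf' = -μf' -
f(s)A, which has three consequences. (a) By symmetry of H, f(s)g(s) = 0 if Hf = μf and Hg = -μg. So
in one of the two eigenspaces all elements vanish at s. (b) Such an eigenspace is zero
(`eq_zero_of_forall_eq_zero`): it is invariant under L, and (Lf)(s) = f'(s), so f'(s) = 0 as well;
then it is invariant under f ↦ f'', and Taylor estimates at s force f = 0. (c) If the eigenspace for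
-μ is zero, an f with Hf = μf and f(s) = 0 has f' = 0, so f is determined by f(s), and the
eigenspace for μ is at most one-dimensional. It also contains every solution of H²g = μ²g, because
Hg - μg belongs to the eigenvalue -μ.

Finally, equal K-eigenvalues would make two eigenfunctions of L proportional, and then their
L-eigenvalues would agree. All pairings are bilinear, and no spectral theorem is used. -/

noncomputable section

/-! ### The Airy function and its derivatives -/

/-- The integrand of the contour integral for the `n`-th derivative of the Airy function. -/
def airyIntegrand (n : ℕ) (x t : ℝ) : ℂ :=
  (Complex.I * ((t : ℂ) + Complex.I)) ^ n * Complex.exp (Complex.I *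
      (((t : ℂ) + Complex.I) ^ 3 / 3 + (x : ℂ) * ((t : ℂ) + Complex.I)))

/-- The `n`-th derivative of the contour integral of the Airy function, without normalization. -/
def airyContour (n : ℕ) (x : ℝ) : ℂ := ∫ t : ℝ, airyIntegrand n x t

/-- The `n`-th derivative of `airyA lam`. -/
def airyDer (lam : ℝ) (n : ℕ) (x : ℝ) : ℝ :=
  Real.sqrt lam * ((1 / (2 * Real.pi)) * (airyContour n x).re)

theorem airyA_eq_airyDer (lam : ℝ) : airyA lam = airyDer lam 0 := by
  funext x
  simp [airyA, airyAi, airyDer, airyContour, airyIntegrand]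

theorem airyPhase_eq (x t : ℝ) :
    Complex.I * (((t : ℂ) + Complex.I) ^ 3 / 3 + (x : ℂ) * ((t : ℂ) + Complex.I)) =
      ((1 / 3 - t ^ 2 - x : ℝ) : ℂ) + ((t ^ 3 / 3 - t + x * t : ℝ) : ℂ) * Complex.I := by
  push_cast
  linear_combination ((t : ℂ) ^ 2 + t * Complex.I + (Complex.I ^ 2 - 1) / 3 + x) * Complex.I_sq

theorem norm_airyIntegrand (n : ℕ) (x t : ℝ) :
    ‖airyIntegrand n x t‖ = ‖(t : ℂ) + Complex.I‖ ^ n * Real.exp (1 / 3 - t ^ 2 - x) := by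
  rw [airyIntegrand, norm_mul, norm_pow, norm_mul, Complex.norm_I, one_mul, Complex.norm_exp,
    airyPhase_eq]
  congr 2
  rw [Complex.add_re, Complex.ofReal_re, Complex.re_ofReal_mul, Complex.I_re, mul_zero, add_zero]

/-- The height 1 of the contour supplies both the Gaussian factor in t and the factor exp(-x), the
only decay of Ai that the proof needs. -/
theorem norm_airyIntegrand_le (n : ℕ) (x t : ℝ) :
    ‖airyIntegrand n x t‖ ≤
      (n.factorial * Real.exp (11 / 6)) * Real.exp (-x) * Real.exp (-(1 / 2) * t ^ 2) := by
  rw [norm_airyIntegrand]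
  have h1 : ‖(t : ℂ) + Complex.I‖ ≤ |t| + 1 := by
    refine (norm_add_le _ _).trans ?_
    simp
  have h2 : ‖(t : ℂ) + Complex.I‖ ^ n ≤ n.factorial * Real.exp (|t| + 1) := by
    refine (pow_le_pow_left₀ (norm_nonneg _) h1 n).trans ?_
    have := Real.pow_div_factorial_le_exp (x := |t| + 1) (by positivity) n
    rw [div_le_iff₀ (by positivity)] at this
    linarith
  calc _ ≤ n.factorial * Real.exp (|t| + 1) * Real.exp (1 / 3 - t ^ 2 - x) := by gcongr
    _ = n.factorial * Real.exp (|t| + 1 + (1 / 3 - t ^ 2 - x)) := by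
      rw [mul_assoc, ← Real.exp_add]
    _ ≤ n.factorial * Real.exp (11 / 6 + -x + -(1 / 2) * t ^ 2) := by
      refine mul_le_mul_of_nonneg_left (Real.exp_le_exp.2 ?_) (by positivity)
      -- 11/6 = 1 + 1/3 + 1/2, where 1/2 comes from |t| ≤ t²/2 + 1/2.
      nlinarith [sq_abs t, sq_nonneg (|t| - 1)]
    _ = _ := by rw [Real.exp_add, Real.exp_add]; ring

theorem continuous_airyIntegrand (n : ℕ) (x : ℝ) : Continuous (airyIntegrand n x) := by
  unfold airyIntegrand
  fun_prop

theorem integrable_airyIntegrand (n : ℕ) (x : ℝ) : Integrable (airyIntegrand n x) := by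
  refine Integrable.mono' ((integrable_exp_neg_mul_sq (b := 1 / 2) (by norm_num)).const_mul
    ((n.factorial * Real.exp (11 / 6)) * Real.exp (-x)))
    (continuous_airyIntegrand n x).aestronglyMeasurable (ae_of_all _ fun t => ?_)
  exact norm_airyIntegrand_le n x t

theorem exists_norm_airyContour_le (n : ℕ) :
    ∃ C : ℝ, 0 ≤ C ∧ ∀ x, ‖airyContour n x‖ ≤ C * Real.exp (-x) := by
  refine ⟨(n.factorial * Real.exp (11 / 6)) * ∫ t : ℝ, Real.exp (-(1 / 2) * t ^ 2),
    mul_nonneg (by positivity) (integral_nonneg fun t => by positivity), fun x => ?_⟩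
  refine (norm_integral_le_of_norm_le ((integrable_exp_neg_mul_sq (b := 1 / 2)
    (by norm_num)).const_mul ((n.factorial * Real.exp (11 / 6)) * Real.exp (-x)))
    (ae_of_all _ (norm_airyIntegrand_le n x))).trans_eq ?_
  rw [integral_const_mul]
  ring

theorem hasDerivAt_airyIntegrand (n : ℕ) (x t : ℝ) :
    HasDerivAt (fun x => airyIntegrand n x t) (airyIntegrand (n + 1) x t) x := by
  have h : HasDerivAt (fun x : ℝ => Complex.I *
      (((t : ℂ) + Complex.I) ^ 3 / 3 + (x : ℂ) * ((t : ℂ) + Complex.I)))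
      (Complex.I * (1 * ((t : ℂ) + Complex.I))) x :=
    (((Complex.ofRealCLM.hasDerivAt (x := x)).mul_const _).const_add _).const_mul _
  refine (h.cexp.const_mul ((Complex.I * ((t : ℂ) + Complex.I)) ^ n)).congr_deriv ?_
  rw [airyIntegrand]
  ring

theorem hasDerivAt_airyContour (n : ℕ) (x : ℝ) :
    HasDerivAt (airyContour n) (airyContour (n + 1) x) x := by
  refine (hasDerivAt_integral_of_dominated_loc_of_deriv_le (μ := volume)
    (F := fun x t => airyIntegrand n x t) (F' := fun x t => airyIntegrand (n + 1) x t)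
    (bound := fun t => ((n + 1).factorial * Real.exp (11 / 6)) * Real.exp (-(x - 1)) *
      Real.exp (-(1 / 2) * t ^ 2))
    (Metric.ball_mem_nhds x one_pos) (Eventually.of_forall fun y =>
      (continuous_airyIntegrand n y).aestronglyMeasurable)
    (integrable_airyIntegrand n x) (continuous_airyIntegrand (n + 1) x).aestronglyMeasurable
    (ae_of_all _ fun t y hy => (norm_airyIntegrand_le (n + 1) y t).trans ?_)
    ((integrable_exp_neg_mul_sq (b := 1 / 2) (by norm_num)).const_mul _)
    (ae_of_all _ fun t y _ => hasDerivAt_airyIntegrand n y t)).2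
  rw [Real.ball_eq_Ioo] at hy
  have := hy.1
  gcongr

/-- The difference of the two integrands is, up to a constant factor, a t-derivative of an
integrable function. -/
theorem airyContour_two (x : ℝ) : airyContour 2 x = x * airyContour 0 x := by
  have hd : ∀ t : ℝ, HasDerivAt (airyIntegrand 0 x)
      (-Complex.I * (airyIntegrand 2 x t - x * airyIntegrand 0 x t)) t := by
    intro t
    have h0 : HasDerivAt (fun t : ℝ => (t : ℂ) + Complex.I) 1 t :=
      (Complex.ofRealCLM.hasDerivAt (x := t)).add_const _
    have h := ((((h0.pow 3).div_const 3).add (h0.const_mul (x : ℂ))).const_mul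
      Complex.I).cexp
    have e : airyIntegrand 0 x = fun t : ℝ => Complex.exp (Complex.I *
      (((t : ℂ) + Complex.I) ^ 3 / 3 + (x : ℂ) * ((t : ℂ) + Complex.I))) := by
      funext t
      simp [airyIntegrand]
    rw [e]
    refine h.congr_deriv ?_
    simp only [airyIntegrand, Pi.add_apply, Pi.pow_apply]
    generalize Complex.exp _ = w
    push_cast
    linear_combination (Complex.I * ((t : ℂ) + Complex.I) ^ 2) * w * Complex.I_sq
  have hi : Integrable fun t => airyIntegrand 2 x t - x * airyIntegrand 0 x t :=
    (integrable_airyIntegrand 2 x).sub ((integrable_airyIntegrand 0 x).const_mul _)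
  have h := integral_eq_zero_of_hasDerivAt_of_integrable hd (hi.const_mul _)
    (integrable_airyIntegrand 0 x)
  rw [integral_const_mul, integral_sub (integrable_airyIntegrand 2 x)
    ((integrable_airyIntegrand 0 x).const_mul _), integral_const_mul, mul_eq_zero] at h
  exact sub_eq_zero.1 (h.resolve_left (by simp))

/-- Conjugation of the integrand amounts to t ↦ -t. -/
theorem airyContour_im (x : ℝ) : (airyContour 0 x).im = 0 := by
  rw [← Complex.conj_eq_iff_im, airyContour, ← integral_conj,
    ← integral_neg_eq_self]
  congr 1
  funext t
  simp only [airyIntegrand, pow_zero, one_mul, ← Complex.exp_conj]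
  congr 1
  have h3 : (starRingEnd ℂ) 3 = 3 := Complex.conj_ofNat 3
  simp [h3]
  ring

theorem airyDer_two (lam x : ℝ) : airyDer lam 2 x = x * airyDer lam 0 x := by
  simp only [airyDer, airyContour_two, Complex.re_ofReal_mul]
  ring

theorem hasDerivAt_airyDer (lam : ℝ) (n : ℕ) (x : ℝ) :
    HasDerivAt (airyDer lam n) (airyDer lam (n + 1) x) x := by
  have h : HasDerivAt (fun x => (airyContour n x).re) (airyContour (n + 1) x).re x :=
    Complex.reCLM.hasFDerivAt.comp_hasDerivAt x (hasDerivAt_airyContour n x)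
  exact (h.const_mul _).const_mul _

theorem continuous_airyDer (lam : ℝ) (n : ℕ) : Continuous (airyDer lam n) :=
  continuous_iff_continuousAt.2 fun x => (hasDerivAt_airyDer lam n x).continuousAt

theorem exists_abs_airyDer_le (lam : ℝ) (n : ℕ) :
    ∃ C : ℝ, 0 ≤ C ∧ ∀ x, |airyDer lam n x| ≤ C * Real.exp (-x) := by
  obtain ⟨C, hC, h⟩ := exists_norm_airyContour_le n
  refine ⟨Real.sqrt lam * ((1 / (2 * Real.pi)) * C), by positivity, fun x => ?_⟩
  rw [airyDer, abs_mul, abs_mul, abs_of_nonneg (Real.sqrt_nonneg _),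
    abs_of_nonneg (by positivity : 0 ≤ 1 / (2 * Real.pi)), mul_assoc, mul_assoc]
  have := (Complex.abs_re_le_norm _).trans (h x)
  gcongr

/-- Uniqueness for the linear system `u' = α v`, `v' = β u`. -/
theorem linear_system_eq_zero {a b x₀ : ℝ} {α β u v : ℝ → ℂ} (hx₀ : x₀ ∈ Ioo a b)
    (hα : ContinuousOn α (Icc a b)) (hβ : ContinuousOn β (Icc a b))
    (hu : ∀ t ∈ Ioo a b, HasDerivAt u (α t * v t) t)
    (hv : ∀ t ∈ Ioo a b, HasDerivAt v (β t * u t) t) (hu0 : u x₀ = 0) (hv0 : v x₀ = 0) :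
    ∀ x ∈ Ioo a b, u x = 0 := by
  obtain ⟨A, hA⟩ := isCompact_Icc.exists_bound_of_continuousOn hα
  obtain ⟨B, hB⟩ := isCompact_Icc.exists_bound_of_continuousOn hβ
  set M := max (max A B) 0 with hM
  have hM0 : 0 ≤ M := le_max_right _ _
  have key := ODE_solution_unique_of_mem_Ioo (E := ℂ × ℂ) (K := M.toNNReal)
    (v := fun t p => (α t * p.2, β t * p.1)) (s := fun _ => univ) (f := fun t => (u t, v t))
    (g := fun _ => 0) (t₀ := x₀) (a := a) (b := b) ?_ hx₀
    (fun t ht => ⟨(hu t ht).prodMk (hv t ht), mem_univ _⟩)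
    (fun t ht => ⟨?_, mem_univ _⟩) ?_
  · intro x hx
    exact congrArg Prod.fst (key hx)
  · intro t ht
    refine LipschitzOnWith.of_dist_le_mul fun p _ q _ => ?_
    have ht' := Ioo_subset_Icc_self ht
    have h1 : ‖α t‖ ≤ M := (hA t ht').trans ((le_max_left _ _).trans (le_max_left _ _))
    have h2 : ‖β t‖ ≤ M := (hB t ht').trans ((le_max_right _ _).trans (le_max_left _ _))
    rw [Real.coe_toNNReal _ hM0, Prod.dist_eq, Prod.dist_eq]
    simp only [dist_eq_norm, ← mul_sub, norm_mul]
    refine max_le ?_ ?_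
    · exact mul_le_mul h1 (le_max_right _ _) (norm_nonneg _) hM0
    · exact mul_le_mul h2 (le_max_left _ _) (norm_nonneg _) hM0
  · refine (hasDerivAt_const t (0 : ℂ × ℂ)).congr_deriv ?_
    simp [Prod.ext_iff]
  · simp [hu0, hv0]

/-- An integrable function whose Fourier transform vanishes is zero. -/
theorem ae_eq_zero_of_integral_exp_mul_eq_zero {m : ℝ → ℂ} (hm : Integrable m)
    (h : ∀ τ : ℝ, ∫ y : ℝ, Complex.exp (Complex.I * τ * y) * m y = 0) : m =ᵐ[volume] 0 := by
  have hF : FourierTransform.fourier m = fun _ => (0 : ℂ) := by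
    funext w
    rw [Real.fourier_eq']
    rw [← h (-2 * Real.pi * w)]
    congr 1
    funext y
    rw [smul_eq_mul]
    congr 2
    simp
    ring
  -- A test function is the Fourier transform of a Schwartz function `ψ`, so the transform can be
  -- moved onto `m`, where it vanishes.
  refine ae_eq_zero_of_integral_contDiff_smul_eq_zero hm.locallyIntegrable fun g hg hc => ?_
  have hg₁ : HasCompactSupport (Complex.ofRealCLM ∘ g) := hc.comp_left rfl
  have hg₂ : ContDiff ℝ (⊤ : ℕ∞) (Complex.ofRealCLM ∘ g) := by fun_prop
  set φ : SchwartzMap ℝ ℂ := hg₁.toSchwartzMap hg₂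
  set ψ : SchwartzMap ℝ ℂ := FourierTransformInv.fourierInv φ
  have hψ : FourierTransform.fourier (ψ : ℝ → ℂ) = φ := by
    rw [← SchwartzMap.fourier_coe]
    simp [ψ]
  have e := VectorFourier.integral_fourierIntegral_smul_eq_flip (L := innerₗ ℝ)
      Real.continuous_fourierChar continuous_inner hm (ψ.integrable (μ := volume))
  have e1 : VectorFourier.fourierIntegral Real.fourierChar volume (innerₗ ℝ) m = 0 := hF
  have e2 : VectorFourier.fourierIntegral Real.fourierChar volume (innerₗ ℝ).flip (ψ : ℝ → ℂ)
      = φ := by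
    rw [← hψ]
    simp only [flip_innerₗ]
    rfl
  rw [e1, e2] at e
  simp only [Pi.zero_apply, zero_smul, integral_zero] at e
  rw [e]
  congr 1
  funext x
  simp [φ, mul_comm]

/-- Up to the factor exp(-x), the contour integral is a Fourier transform of the integrand at x = 0,
which is continuous and not zero. -/
theorem exists_airyDer_ne_zero {lam : ℝ} (hlam : 0 < lam) : ∃ x, airyDer lam 0 x ≠ 0 := by
  by_contra! h
  have h0 : ∀ x, airyContour 0 x = 0 := fun x => by
    refine Complex.ext ?_ (airyContour_im x)
    have := h x
    have hs := Real.sqrt_pos.2 hlam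
    simpa [airyDer, hs.ne', Real.pi_ne_zero] using this
  have h1 := ae_eq_zero_of_integral_exp_mul_eq_zero (integrable_airyIntegrand 0 0) fun τ => by
    have := h0 τ
    rw [airyContour] at this
    have e : ∀ t : ℝ, airyIntegrand 0 τ t =
        Complex.exp (-τ) * (Complex.exp (Complex.I * τ * t) * airyIntegrand 0 0 t) := by
      intro t
      simp only [airyIntegrand, ← Complex.exp_add, pow_zero, one_mul]
      congr 1
      push_cast
      linear_combination τ * Complex.I_sq
    simp_rw [e] at this
    rw [integral_const_mul] at this
    simpa using this
  have h2 : airyIntegrand 0 0 = 0 :=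
    (continuous_airyIntegrand 0 0).ae_eq_iff_eq volume continuous_const |>.1 h1
  have := congrFun h2 0
  simp [airyIntegrand] at this

theorem tendsto_airyDer_atTop (lam : ℝ) (n : ℕ) : Tendsto (airyDer lam n) atTop (𝓝 0) := by
  obtain ⟨C, -, h⟩ := exists_abs_airyDer_le lam n
  refine squeeze_zero_norm h ?_
  simpa using (Real.tendsto_exp_neg_atTop_nhds_zero).const_mul C

/-- The product A A' has derivative A'² + yA² ≥ 0 for y ≥ 0 and tends to 0 at infinity. A zero of A
at x forces the product to vanish on [x, ∞), so A and A' vanish together at x + 1, and uniqueness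
for the Airy equation makes A identically zero. -/
theorem airyDer_zero_ne_zero {lam : ℝ} (hlam : 0 < lam) {x : ℝ} (hx : 0 ≤ x) :
    airyDer lam 0 x ≠ 0 := by
  intro hzero
  set v := fun y => airyDer lam 0 y * airyDer lam 1 y with hv
  have hd : ∀ y, HasDerivAt v (airyDer lam 1 y ^ 2 + y * airyDer lam 0 y ^ 2) y := fun y => by
    refine ((hasDerivAt_airyDer lam 0 y).mul (hasDerivAt_airyDer lam 1 y)).congr_deriv ?_
    rw [airyDer_two]
    ring
  have hmono : MonotoneOn v (Ici x) := by
    refine monotoneOn_of_deriv_nonneg (convex_Ici x)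
      (fun y _ => (hd y).continuousAt.continuousWithinAt)
      (fun y _ => (hd y).differentiableAt.differentiableWithinAt) fun y hy => ?_
    rw [interior_Ici] at hy
    rw [(hd y).deriv]
    have : 0 ≤ y := hx.trans (le_of_lt hy)
    positivity
  have hlim : Tendsto v atTop (𝓝 0) := by
    simpa using (tendsto_airyDer_atTop lam 0).mul (tendsto_airyDer_atTop lam 1)
  have hv0 : ∀ y, x ≤ y → v y = 0 := by
    intro y hy
    refine le_antisymm ?_ ?_
    · refine ge_of_tendsto hlim ((eventually_ge_atTop y).mono fun z hz => ?_)
      exact hmono hy (hy.trans hz) hz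
    · have := hmono (self_mem_Ici : x ∈ Ici x) hy hy
      simpa [hv, hzero] using this
  have hz : airyDer lam 1 (x + 1) ^ 2 + (x + 1) * airyDer lam 0 (x + 1) ^ 2 = 0 := by
    rw [← (hd (x + 1)).deriv]
    have : v =ᶠ[𝓝 (x + 1)] fun _ => 0 :=
      by
      filter_upwards [Ioi_mem_nhds (by linarith : x < x + 1)] with y hy using hv0 y (le_of_lt hy)
    rw [this.deriv_eq, deriv_const]
  have hp : 0 < x + 1 := by linarith
  have h0 : airyDer lam 0 (x + 1) = 0 := by
    by_contra hne
    have := mul_pos hp (sq_pos_of_ne_zero hne)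
    nlinarith [sq_nonneg (airyDer lam 1 (x + 1))]
  have h1 : airyDer lam 1 (x + 1) = 0 := by simpa [h0] using hz
  obtain ⟨z, hz⟩ := exists_airyDer_ne_zero hlam
  have key := linear_system_eq_zero (a := min z (x + 1) - 1) (b := max z (x + 1) + 1)
    (x₀ := x + 1) (α := fun _ => 1) (β := fun t => (t : ℂ))
    (u := fun t => (airyDer lam 0 t : ℂ)) (v := fun t => (airyDer lam 1 t : ℂ))
    ⟨by linarith [min_le_right z (x + 1)], by linarith [le_max_right z (x + 1)]⟩
    continuousOn_const Complex.continuous_ofReal.continuousOn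
    (fun t _ => by simpa using (hasDerivAt_airyDer lam 0 t).ofReal_comp)
    (fun t _ => by simpa [airyDer_two] using (hasDerivAt_airyDer lam 1 t).ofReal_comp)
    (by simp [h0]) (by simp [h1]) z
    ⟨by linarith [min_le_left z (x + 1)], by linarith [le_max_left z (x + 1)]⟩
  exact hz (by simpa using key)

/-! ### Functions of subexponential growth and the Hankel operator -/

/-- `f` is integrable on `(s, ∞)` against every decaying exponential. -/
def Subexp (s : ℝ) (f : ℝ → ℂ) : Prop :=
  ∀ c : ℝ, 0 < c → IntegrableOn (fun y => (Real.exp (-c * y) : ℂ) * f y) (Ioi s)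

/-- The Hankel operator with kernel the `n`-th derivative of `airyA lam` at `x + y - s`. -/
def airyHankel (lam s : ℝ) (n : ℕ) (f : ℝ → ℂ) (x : ℝ) : ℂ :=
  ∫ y in Ioi s, (airyDer lam n (x + y - s) : ℂ) * f y

/-- The weighted `L¹` norm of `f` on `(s, ∞)` with weight `exp (-y)`. -/
def expNorm (s : ℝ) (f : ℝ → ℂ) : ℝ := ∫ y in Ioi s, Real.exp (-y) * ‖f y‖

variable {lam s : ℝ} {f g : ℝ → ℂ}

theorem expNorm_nonneg : 0 ≤ expNorm s f := integral_nonneg fun y => by positivity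

theorem Subexp.aestronglyMeasurable (hf : Subexp s f) :
    AEStronglyMeasurable f (volume.restrict (Ioi s)) := by
  have h := (hf 1 one_pos).aestronglyMeasurable
  have hc : Continuous fun y : ℝ => (Real.exp y : ℂ) := by fun_prop
  refine (hc.aestronglyMeasurable.mul h).congr (ae_of_all _ fun y => ?_)
  simp only [Pi.mul_apply]
  rw [← mul_assoc, ← Complex.ofReal_mul, ← Real.exp_add]
  simp

theorem Subexp.integrableOn_exp_mul_norm (hf : Subexp s f) {c : ℝ} (hc : 0 < c) :
    IntegrableOn (fun y => Real.exp (-c * y) * ‖f y‖) (Ioi s) := by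
  refine (hf c hc).norm.congr (ae_of_all _ fun y => ?_)
  simp only [norm_mul, Complex.norm_real, Real.norm_eq_abs, Real.abs_exp]

theorem Subexp.integrableOn_mul (hf : Subexp s f) (hg : Continuous g) {c C : ℝ} (hc : 0 < c)
    (hb : ∀ y, s < y → ‖g y‖ ≤ C * Real.exp (-c * y)) :
    IntegrableOn (fun y => g y * f y) (Ioi s) := by
  refine ((hf.integrableOn_exp_mul_norm hc).const_mul C).mono'
    (hg.aestronglyMeasurable.mul hf.aestronglyMeasurable)
    ((ae_restrict_mem measurableSet_Ioi).mono fun y hy => ?_)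
  rw [norm_mul, ← mul_assoc]
  exact mul_le_mul_of_nonneg_right (hb y hy) (norm_nonneg _)

theorem Subexp.add (hf : Subexp s f) (hg : Subexp s g) : Subexp s fun y => f y + g y :=
  fun c hc => by
    simp only [mul_add]
    exact (hf c hc).add (hg c hc)

theorem Subexp.const_mul (hf : Subexp s f) (k : ℂ) : Subexp s fun y => k * f y :=
  fun c hc => by
    simp only [mul_left_comm _ k]
    exact (hf c hc).const_mul k

theorem Subexp.sub (hf : Subexp s f) (hg : Subexp s g) : Subexp s fun y => f y - g y :=
  fun c hc => by
    simp only [mul_sub]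
    exact (hf c hc).sub (hg c hc)

theorem Subexp.congr (hf : Subexp s f) (h : f =ᵐ[volume.restrict (Ioi s)] g) : Subexp s g :=
  fun c hc => (hf c hc).congr (h.mono fun y hy => by simp only [hy])

theorem abs_mul_exp_le {s c : ℝ} (hc : 0 < c) {y : ℝ} (hy : s < y) :
    |y| * Real.exp (-c * y) ≤
      (2 / c + |s| * Real.exp (c * |s| / 2)) * Real.exp (-(c / 2) * y) := by
  have e : Real.exp (-c * y) = Real.exp (-(c / 2) * y) * Real.exp (-(c / 2) * y) := by
    rw [← Real.exp_add]
    ring_nf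
  rw [e, ← mul_assoc]
  refine mul_le_mul_of_nonneg_right ?_ (Real.exp_pos _).le
  rcases le_or_gt 0 y with h | h
  · have h1 : c / 2 * y ≤ Real.exp (c / 2 * y) := by
      linarith [Real.add_one_le_exp (c / 2 * y)]
    have h2 : y * Real.exp (-(c / 2) * y) ≤ 2 / c := by
      rw [neg_mul, Real.exp_neg, ← div_eq_mul_inv, div_le_iff₀ (Real.exp_pos _)]
      calc y = 2 / c * (c / 2 * y) := by field_simp
        _ ≤ _ := by gcongr
    rw [abs_of_nonneg h]
    have : 0 ≤ |s| * Real.exp (c * |s| / 2) := by positivity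
    linarith
  · have h1 : |y| ≤ |s| := by
      rw [abs_of_neg h, abs_of_neg (hy.trans h)]
      linarith
    have h2 : Real.exp (-(c / 2) * y) ≤ Real.exp (c * |s| / 2) := by
      refine Real.exp_le_exp.2 ?_
      have := neg_le_abs y
      nlinarith
    have h3 : 0 ≤ 2 / c := by positivity
    have h4 := mul_le_mul h1 h2 (Real.exp_pos _).le (abs_nonneg _)
    linarith

theorem Subexp.id_mul (hf : Subexp s f) : Subexp s fun y => (y : ℂ) * f y := by
  intro c hc
  have := hf.integrableOn_mul (g := fun y : ℝ => (Real.exp (-c * y) : ℂ) * y)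
    (by fun_prop) (half_pos hc) (C := 2 / c + |s| * Real.exp (c * |s| / 2)) fun y hy => by
      rw [norm_mul, Complex.norm_real, Complex.norm_real, Real.norm_eq_abs, Real.norm_eq_abs,
        Real.abs_exp, mul_comm]
      exact abs_mul_exp_le hc hy
  simpa only [mul_assoc] using this

theorem Subexp.sub_mul (hf : Subexp s f) (r : ℝ) :
    Subexp s fun y => ((y - r : ℝ) : ℂ) * f y := by
  have := hf.id_mul.sub (hf.const_mul r)
  refine this.congr (ae_of_all _ fun y => ?_)
  push_cast
  ring

theorem subexp_of_memLp (hf : MemLp f 2 (volume.restrict (Ioi s))) : Subexp s f := by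
  intro c hc
  have h : MemLp (fun y : ℝ => (Real.exp (-c * y) : ℂ)) 2 (volume.restrict (Ioi s)) := by
    refine (memLp_two_iff_integrable_sq_norm (Continuous.aestronglyMeasurable
      (by fun_prop))).2 ?_
    refine (exp_neg_integrableOn_Ioi s (b := 2 * c) (by positivity)).congr
      (ae_of_all _ fun y => ?_)
    simp only [Complex.norm_real, Real.norm_eq_abs, Real.abs_exp, ← Real.exp_nat_mul]
    push_cast
    ring_nf
  exact h.integrable_mul hf

theorem subexp_of_norm_le (hf : Continuous f) {C : ℝ} (hb : ∀ x, ‖f x‖ ≤ C * Real.exp (-x)) :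
    Subexp s f := by
  intro c hc
  refine ((exp_neg_integrableOn_Ioi s (b := 1 + c) (by positivity)).const_mul C).mono'
    (Continuous.aestronglyMeasurable (by fun_prop)) (ae_of_all _ fun y => ?_)
  rw [norm_mul, Complex.norm_real, Real.norm_eq_abs, Real.abs_exp]
  have e : Real.exp (-(1 + c) * y) = Real.exp (-c * y) * Real.exp (-y) := by
    rw [← Real.exp_add]
    ring_nf
  rw [e, mul_left_comm]
  exact mul_le_mul_of_nonneg_left (hb y) (Real.exp_pos _).le

theorem exists_norm_airyDer_shift_le (lam s : ℝ) (n : ℕ) : ∃ C : ℝ, 0 ≤ C ∧ ∀ x y : ℝ,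
    ‖(airyDer lam n (x + y - s) : ℂ)‖ ≤ C * Real.exp (-x) * Real.exp (-y) := by
  obtain ⟨C, hC, h⟩ := exists_abs_airyDer_le lam n
  refine ⟨C * Real.exp s, by positivity, fun x y => ?_⟩
  rw [Complex.norm_real, Real.norm_eq_abs]
  refine (h _).trans_eq ?_
  rw [mul_assoc, mul_assoc, ← Real.exp_add, ← Real.exp_add]
  ring_nf

theorem continuous_airyDer_shift (lam s : ℝ) (n : ℕ) (x : ℝ) :
    Continuous fun y : ℝ => (airyDer lam n (x + y - s) : ℂ) :=
  Complex.continuous_ofReal.comp ((continuous_airyDer lam n).comp (by fun_prop))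

theorem Subexp.integrableOn_airyDer_mul (hf : Subexp s f) (lam : ℝ) (n : ℕ) (x : ℝ) :
    IntegrableOn (fun y => (airyDer lam n (x + y - s) : ℂ) * f y) (Ioi s) := by
  obtain ⟨C, -, h⟩ := exists_norm_airyDer_shift_le lam s n
  refine hf.integrableOn_mul (continuous_airyDer_shift lam s n x) one_pos
    (C := C * Real.exp (-x)) fun y _ => ?_
  rw [neg_one_mul]
  exact h x y

/-- The uniformity of `C` in `f` is what later allows the bound to be iterated on an eigenspace. -/
theorem exists_norm_airyHankel_le (lam s : ℝ) (n : ℕ) : ∃ C : ℝ, 0 ≤ C ∧ ∀ f, Subexp s f →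
    ∀ x, ‖airyHankel lam s n f x‖ ≤ C * expNorm s f * Real.exp (-x) := by
  obtain ⟨C, hC, h⟩ := exists_norm_airyDer_shift_le lam s n
  refine ⟨C, hC, fun f hf x => ?_⟩
  have hi := hf.integrableOn_exp_mul_norm one_pos
  simp only [neg_one_mul] at hi
  refine (norm_integral_le_of_norm_le (hi.const_mul (C * Real.exp (-x)))
    (ae_of_all _ fun y => ?_)).trans_eq ?_
  · rw [norm_mul, ← mul_assoc]
    exact mul_le_mul_of_nonneg_right (h x y) (norm_nonneg _)
  · rw [integral_const_mul, expNorm]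
    ring

theorem hasDerivAt_airyHankel (hf : Subexp s f) (lam : ℝ) (n : ℕ) (x : ℝ) :
    HasDerivAt (airyHankel lam s n f) (airyHankel lam s (n + 1) f x) x := by
  obtain ⟨C, hC, h⟩ := exists_norm_airyDer_shift_le lam s (n + 1)
  have hi := hf.integrableOn_exp_mul_norm one_pos
  simp only [neg_one_mul] at hi
  refine (hasDerivAt_integral_of_dominated_loc_of_deriv_le
    (F := fun x y => (airyDer lam n (x + y - s) : ℂ) * f y)
    (F' := fun x y => (airyDer lam (n + 1) (x + y - s) : ℂ) * f y)
    (bound := fun y => C * Real.exp (-(x - 1)) * (Real.exp (-y) * ‖f y‖))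
    (Metric.ball_mem_nhds x one_pos) (Eventually.of_forall fun z =>
      (continuous_airyDer_shift lam s n z).aestronglyMeasurable.mul hf.aestronglyMeasurable)
    (hf.integrableOn_airyDer_mul lam n x)
    (hf.integrableOn_airyDer_mul lam (n + 1) x).aestronglyMeasurable
    (ae_of_all _ fun y z hz => ?_) (hi.const_mul _) (ae_of_all _ fun y z _ => ?_)).2
  · rw [norm_mul, ← mul_assoc]
    refine mul_le_mul_of_nonneg_right ((h z y).trans ?_) (norm_nonneg _)
    rw [Real.ball_eq_Ioo] at hz
    have := hz.1
    gcongr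
  · have h0 : HasDerivAt (fun z : ℝ => z + y - s) 1 z :=
      ((hasDerivAt_id z).add_const y).sub_const s
    have h1 := (hasDerivAt_airyDer lam n (z + y - s)).comp z h0
    rw [mul_one] at h1
    exact h1.ofReal_comp.mul_const _

theorem continuous_airyHankel (hf : Subexp s f) (lam : ℝ) (n : ℕ) :
    Continuous (airyHankel lam s n f) :=
  continuous_iff_continuousAt.2 fun x => (hasDerivAt_airyHankel hf lam n x).continuousAt

theorem subexp_airyHankel (hf : Subexp s f) (lam : ℝ) (n : ℕ) (r : ℝ) :
    Subexp r (airyHankel lam s n f) := by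
  obtain ⟨C, -, h⟩ := exists_norm_airyHankel_le lam s n
  exact subexp_of_norm_le (continuous_airyHankel hf lam n) (h f hf)

theorem airyHankel_congr (h : ∀ᵐ y ∂(volume.restrict (Ioi s)), f y = g y) (n : ℕ) (x : ℝ) :
    airyHankel lam s n f x = airyHankel lam s n g x :=
  integral_congr_ae (h.mono fun y hy => by simp only [hy])

theorem airyHankel_add (hf : Subexp s f) (hg : Subexp s g) (n : ℕ) (x : ℝ) :
    airyHankel lam s n (fun y => f y + g y) x =
      airyHankel lam s n f x + airyHankel lam s n g x := by
  simp only [airyHankel, mul_add]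
  exact integral_add (hf.integrableOn_airyDer_mul lam n x) (hg.integrableOn_airyDer_mul lam n x)

theorem airyHankel_const_mul (k : ℂ) (n : ℕ) (x : ℝ) :
    airyHankel lam s n (fun y => k * f y) x = k * airyHankel lam s n f x := by
  simp only [airyHankel, mul_left_comm _ k]
  exact integral_const_mul _ _

/-- The Airy equation at w = x + (y - s). -/
theorem airyHankel_two (hf : Subexp s f) (x : ℝ) :
    airyHankel lam s 2 f x = (x : ℂ) * airyHankel lam s 0 f x +
      airyHankel lam s 0 (fun y => ((y - s : ℝ) : ℂ) * f y) x := by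
  have h1 := (hf.integrableOn_airyDer_mul lam 0 x).const_mul (x : ℂ)
  have h2 := (hf.sub_mul s).integrableOn_airyDer_mul lam 0 x
  rw [airyHankel, airyHankel, airyHankel, ← integral_const_mul, ← integral_add h1 h2]
  congr 1
  funext y
  rw [airyDer_two]
  push_cast
  ring

/-- Fubini and the symmetry of x + y - s; the pairing has no complex conjugate. -/
theorem integral_airyHankel_mul (hf : Subexp s f) (hg : Subexp s g) (n : ℕ) :
    ∫ x in Ioi s, airyHankel lam s n f x * g x = ∫ y in Ioi s, f y * airyHankel lam s n g y := by
  obtain ⟨C, hC, h⟩ := exists_norm_airyDer_shift_le lam s n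
  have hi1 := hf.integrableOn_exp_mul_norm one_pos
  have hi2 := hg.integrableOn_exp_mul_norm one_pos
  simp only [neg_one_mul] at hi1 hi2
  have hint : Integrable (Function.uncurry fun x y : ℝ =>
      (airyDer lam n (x + y - s) : ℂ) * f y * g x)
      ((volume.restrict (Ioi s)).prod (volume.restrict (Ioi s))) := by
    refine ((hi2.mul_prod hi1).const_mul C).mono' ?_ (ae_of_all _ fun p => ?_)
    · have hc : Continuous fun p : ℝ × ℝ => (airyDer lam n (p.1 + p.2 - s) : ℂ) :=
        Complex.continuous_ofReal.comp ((continuous_airyDer lam n).comp (by fun_prop))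
      exact (hc.aestronglyMeasurable.mul hf.aestronglyMeasurable.comp_snd).mul
        hg.aestronglyMeasurable.comp_fst
    · simp only [Function.uncurry, norm_mul]
      calc _ ≤ C * Real.exp (-p.1) * Real.exp (-p.2) * ‖f p.2‖ * ‖g p.1‖ := by
            gcongr
            exact h _ _
        _ = _ := by ring
  calc _ = ∫ x in Ioi s, ∫ y in Ioi s, (airyDer lam n (x + y - s) : ℂ) * f y * g x := by
        congr 1
        funext x
        rw [airyHankel, ← integral_mul_const]
    _ = ∫ y in Ioi s, ∫ x in Ioi s, (airyDer lam n (x + y - s) : ℂ) * f y * g x :=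
        integral_integral_swap hint
    _ = _ := by
        congr 1
        funext y
        rw [airyHankel, ← integral_const_mul]
        congr 1
        funext x
        rw [add_comm y x]
        ring

/-! ### The Airy kernel as the square of the Hankel kernel -/

theorem deriv_airyA (lam : ℝ) : deriv (airyA lam) = airyDer lam 1 := by
  rw [airyA_eq_airyDer]
  exact funext fun x => (hasDerivAt_airyDer lam 0 x).deriv

theorem deriv_deriv_airyA (lam : ℝ) : deriv (deriv (airyA lam)) = airyDer lam 2 := by
  rw [deriv_airyA]
  exact funext fun x => (hasDerivAt_airyDer lam 1 x).deriv

/-- The integrand has an explicit antiderivative in z that vanishes at infinity: the Wronskian-type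
quotient off the diagonal, and A A'' - A'² on it. -/
theorem integral_airyDer_mul_airyDer (lam s x y : ℝ) :
    ∫ z in Ioi s, airyDer lam 0 (x + z - s) * airyDer lam 0 (y + z - s) =
      airyKernel lam x y := by
  have hsh : ∀ (n : ℕ) (x z : ℝ), HasDerivAt (fun z => airyDer lam n (x + z - s))
      (airyDer lam (n + 1) (x + z - s)) z := fun n x z => by
    have h0 : HasDerivAt (fun z : ℝ => x + z - s) 1 z :=
      ((hasDerivAt_id z).const_add x).sub_const s
    have h1 := (hasDerivAt_airyDer lam n (x + z - s)).comp z h0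
    rwa [mul_one] at h1
  have hlim : ∀ (n : ℕ) (x : ℝ), Tendsto (fun z => airyDer lam n (x + z - s)) atTop (𝓝 0) :=
    fun n x => (tendsto_airyDer_atTop lam n).comp
      (tendsto_atTop_add_const_right _ (-s) (tendsto_atTop_add_const_left _ x tendsto_id))
  have hint : IntegrableOn
      (fun z => airyDer lam 0 (x + z - s) * airyDer lam 0 (y + z - s)) (Ioi s) := by
    obtain ⟨C, hC, h⟩ := exists_norm_airyDer_shift_le lam s 0
    simp only [Complex.norm_real, Real.norm_eq_abs] at h
    refine ((exp_neg_integrableOn_Ioi s two_pos).const_mul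
      (C * Real.exp (-x) * (C * Real.exp (-y)))).mono' (Continuous.aestronglyMeasurable
      (((continuous_airyDer lam 0).comp (by fun_prop)).mul
        ((continuous_airyDer lam 0).comp (by fun_prop)))) (ae_of_all _ fun z => ?_)
    rw [Real.norm_eq_abs, abs_mul]
    refine (mul_le_mul (h x z) (h y z) (abs_nonneg _) (by positivity)).trans_eq ?_
    rw [show -2 * z = -z + -z by ring, Real.exp_add]
    ring
  rw [airyKernel, deriv_deriv_airyA, deriv_airyA, airyA_eq_airyDer]
  split_ifs with hxy
  · subst hxy
    have hd : ∀ z ∈ Ici s, HasDerivAt (fun z => airyDer lam 0 (x + z - s) *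
        airyDer lam 2 (x + z - s) - airyDer lam 1 (x + z - s) ^ 2)
        (airyDer lam 0 (x + z - s) * airyDer lam 0 (x + z - s)) z := fun z _ => by
      have e : ∀ w, airyDer lam 3 w = airyDer lam 0 w + w * airyDer lam 1 w := fun w => by
        have h2 : HasDerivAt (airyDer lam 2) (1 * airyDer lam 0 w + w * airyDer lam 1 w) w := by
          rw [show airyDer lam 2 = fun w => w * airyDer lam 0 w from funext (airyDer_two lam)]
          exact (hasDerivAt_id w).mul (hasDerivAt_airyDer lam 0 w)
        rw [(hasDerivAt_airyDer lam 2 w).unique h2, one_mul]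
      refine (((hsh 0 x z).mul (hsh 2 x z)).sub ((hsh 1 x z).pow 2)).congr_deriv ?_
      simp only [zero_add, Nat.reduceAdd, e, airyDer_two]
      push_cast
      ring
    have hl : Tendsto (fun z => airyDer lam 0 (x + z - s) *
        airyDer lam 2 (x + z - s) - airyDer lam 1 (x + z - s) ^ 2) atTop (𝓝 0) := by
      simpa using ((hlim 0 x).mul (hlim 2 x)).sub ((hlim 1 x).pow 2)
    rw [integral_Ioi_of_hasDerivAt_of_tendsto' hd hint hl]
    simp
  · have hxy' : x - y ≠ 0 := sub_ne_zero.2 hxy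
    have hd : ∀ z ∈ Ici s, HasDerivAt (fun z => (airyDer lam 1 (x + z - s) *
        airyDer lam 0 (y + z - s) - airyDer lam 0 (x + z - s) * airyDer lam 1 (y + z - s)) /
          (x - y))
        (airyDer lam 0 (x + z - s) * airyDer lam 0 (y + z - s)) z := fun z _ => by
      refine ((((hsh 1 x z).mul (hsh 0 y z)).sub
        ((hsh 0 x z).mul (hsh 1 y z))).div_const (x - y)).congr_deriv ?_
      simp only [zero_add, Nat.reduceAdd, airyDer_two]
      field_simp
      ring
    have hl : Tendsto (fun z => (airyDer lam 1 (x + z - s) *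
        airyDer lam 0 (y + z - s) - airyDer lam 0 (x + z - s) * airyDer lam 1 (y + z - s)) /
          (x - y)) atTop (𝓝 0) := by
      simpa using (((hlim 1 x).mul (hlim 0 y)).sub ((hlim 0 x).mul (hlim 1 y))).div_const (x - y)
    rw [integral_Ioi_of_hasDerivAt_of_tendsto' hd hint hl]
    simp only [add_sub_cancel_right]
    field_simp
    ring

theorem airyHankel_airyDer (lam s x y : ℝ) :
    airyHankel lam s 0 (fun z => (airyDer lam 0 (x + z - s) : ℂ)) y = airyKernel lam x y := by
  rw [← integral_airyDer_mul_airyDer lam s x y, ← integral_complex_ofReal, airyHankel]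
  congr 1
  funext z
  push_cast
  ring

theorem subexp_airyDer_shift (lam s x : ℝ) (n : ℕ) :
    Subexp s fun z => (airyDer lam n (x + z - s) : ℂ) := by
  obtain ⟨C, -, h⟩ := exists_norm_airyDer_shift_le lam s n
  exact subexp_of_norm_le (continuous_airyDer_shift lam s n x) (h x)

theorem integral_airyKernel_mul (hf : Subexp s f) (lam x : ℝ) :
    ∫ y in Ioi s, (airyKernel lam x y : ℂ) * f y =
      airyHankel lam s 0 (airyHankel lam s 0 f) x := by
  simp only [← airyHankel_airyDer lam s x]
  exact integral_airyHankel_mul (subexp_airyDer_shift lam s x 0) hf 0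

theorem integrableOn_airyKernel_mul (hf : Subexp s f) (lam x : ℝ) :
    IntegrableOn (fun y => (airyKernel lam x y : ℂ) * f y) (Ioi s) := by
  simp only [← airyHankel_airyDer lam s x]
  have hs := subexp_airyDer_shift lam s x 0
  obtain ⟨C, -, h⟩ := exists_norm_airyHankel_le lam s 0
  refine hf.integrableOn_mul (continuous_airyHankel hs lam 0) one_pos
    (C := C * expNorm s fun z => (airyDer lam 0 (x + z - s) : ℂ)) fun y _ => ?_
  rw [neg_one_mul]
  exact h _ hs y

/-! ### Injectivity of the Hankel operator -/

/-- The exponential is expanded and integrated termwise. With |τ| ≤ c/2, half of the exponential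
weight dominates the series and the other half absorbs (y - s)^k. -/
theorem moment_exp_mul_eq_zero {m : ℝ → ℂ} {c τ : ℝ} (hc : 0 < c)
    (hm : AEStronglyMeasurable m (volume.restrict (Ioi s)))
    (hint : IntegrableOn (fun y => Real.exp (c * (y - s)) * ‖m y‖) (Ioi s))
    (hmom : ∀ k : ℕ, ∫ y in Ioi s, ((y - s : ℝ) : ℂ) ^ k * m y = 0) (hτ : |τ| ≤ c / 2) (k : ℕ) :
    ∫ y in Ioi s, ((y - s : ℝ) : ℂ) ^ k *
      (Complex.exp (Complex.I * τ * ((y - s : ℝ) : ℂ)) * m y) = 0 := by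
  have hsum : ∀ y : ℝ, HasSum (fun j : ℕ => (y - s) ^ k * ((|τ| * (y - s)) ^ j / j.factorial) *
      ‖m y‖) ((y - s) ^ k * Real.exp (|τ| * (y - s)) * ‖m y‖) := fun y => by
    rw [Real.exp_eq_exp_ℝ]
    exact ((NormedSpace.expSeries_div_hasSum_exp (|τ| * (y - s))).mul_left _).mul_right _
  have key := hasSum_integral_of_dominated_convergence (μ := volume.restrict (Ioi s))
    (F := fun (j : ℕ) (y : ℝ) => ((y - s : ℝ) : ℂ) ^ k *
      ((Complex.I * τ * ((y - s : ℝ) : ℂ)) ^ j / j.factorial * m y))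
    (f := fun y => ((y - s : ℝ) : ℂ) ^ k *
      (Complex.exp (Complex.I * τ * ((y - s : ℝ) : ℂ)) * m y))
    (fun j y => (y - s) ^ k * ((|τ| * (y - s)) ^ j / j.factorial) * ‖m y‖)
    (fun j => ?_) (fun j => ?_) (ae_of_all _ fun y => (hsum y).summable) ?_
    (ae_of_all _ fun y => ?_)
  · have hz : ∀ j : ℕ, ∫ y in Ioi s, ((y - s : ℝ) : ℂ) ^ k *
      ((Complex.I * τ * ((y - s : ℝ) : ℂ)) ^ j / j.factorial * m y) = 0 := fun j => by
      rw [← mul_zero ((Complex.I * τ) ^ j / j.factorial), ← hmom (k + j), ← integral_const_mul]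
      congr 1
      funext y
      ring
    simp only [hz] at key
    exact key.unique hasSum_zero
  · refine Continuous.aestronglyMeasurable (by fun_prop) |>.mul
      (Continuous.aestronglyMeasurable (by fun_prop) |>.mul hm)
  · filter_upwards [ae_restrict_mem measurableSet_Ioi] with y hy
    have hy' : 0 < y - s := sub_pos.2 hy
    simp only [norm_mul, norm_pow, norm_div, Complex.norm_I, Complex.norm_real, Real.norm_eq_abs,
      one_mul, abs_of_pos hy', RCLike.norm_natCast, mul_assoc]
    exact le_rfl
  · simp only [(hsum _).tsum_eq]
    refine (hint.const_mul (k.factorial * (2 / c) ^ k)).mono'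
      ((Continuous.aestronglyMeasurable (by fun_prop)).mul hm.norm) ?_
    filter_upwards [ae_restrict_mem measurableSet_Ioi] with y hy
    have hy' : 0 < y - s := sub_pos.2 hy
    rw [Real.norm_eq_abs, abs_of_nonneg (by positivity), ← mul_assoc]
    refine mul_le_mul_of_nonneg_right ?_ (norm_nonneg _)
    have h1 := Real.pow_div_factorial_le_exp (x := c / 2 * (y - s)) (by positivity) k
    rw [div_le_iff₀ (by positivity)] at h1
    have h2 : (y - s) ^ k ≤ k.factorial * (2 / c) ^ k * Real.exp (c / 2 * (y - s)) := by
      calc (y - s) ^ k = (2 / c) ^ k * (c / 2 * (y - s)) ^ k := by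
            rw [← mul_pow]
            congr 1
            field_simp
        _ ≤ (2 / c) ^ k * (Real.exp (c / 2 * (y - s)) * k.factorial) := by gcongr
        _ = _ := by ring
    have h3 : Real.exp (|τ| * (y - s)) ≤ Real.exp (c / 2 * (y - s)) := by gcongr
    calc _ ≤ k.factorial * (2 / c) ^ k * Real.exp (c / 2 * (y - s)) *
          Real.exp (c / 2 * (y - s)) := by gcongr
      _ = _ := by
        rw [mul_assoc, ← Real.exp_add]
        ring_nf
  · have h := NormedSpace.expSeries_div_hasSum_exp (Complex.I * τ * ((y - s : ℝ) : ℂ))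
    rw [← Complex.exp_eq_exp_ℂ] at h
    exact (h.mul_right (m y)).mul_left (((y - s : ℝ) : ℂ) ^ k)

/-- An exponentially decaying function on a half line is determined by its moments. -/
theorem ae_eq_zero_of_moments_eq_zero {m : ℝ → ℂ} {c : ℝ} (hc : 0 < c)
    (hm : AEStronglyMeasurable m (volume.restrict (Ioi s)))
    (hint : IntegrableOn (fun y => Real.exp (c * (y - s)) * ‖m y‖) (Ioi s))
    (hmom : ∀ k : ℕ, ∫ y in Ioi s, ((y - s : ℝ) : ℂ) ^ k * m y = 0) :
    m =ᵐ[volume.restrict (Ioi s)] 0 := by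
  -- The unimodular factor does not change the norm of `m`, so the same c serves at every step, and
  -- n small steps reach any frequency.
  have hall : ∀ τ : ℝ, |τ| ≤ c / 2 → ∀ n k : ℕ, ∫ y in Ioi s, ((y - s : ℝ) : ℂ) ^ k *
      (Complex.exp (Complex.I * (n * τ : ℝ) * ((y - s : ℝ) : ℂ)) * m y) = 0 := by
    intro τ hτ n
    induction n with
    | zero => simpa using hmom
    | succ n ih =>
      intro k
      have h := moment_exp_mul_eq_zero (τ := τ) hc
        (m := fun y => Complex.exp (Complex.I * (n * τ : ℝ) * ((y - s : ℝ) : ℂ)) * m y)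
        ((Continuous.aestronglyMeasurable (by fun_prop)).mul hm)
        (hint.congr (ae_of_all _ fun y => ?_)) ih hτ k
      · rw [← h]
        congr 1
        funext y
        rw [← mul_assoc (Complex.exp _) (Complex.exp _), ← Complex.exp_add]
        push_cast
        ring_nf
      · have : Complex.I * (n * τ : ℝ) * ((y - s : ℝ) : ℂ) =
            ((n * τ * (y - s) : ℝ) : ℂ) * Complex.I := by
          push_cast
          ring
        simp only [norm_mul, this, Complex.norm_exp_ofReal_mul_I, one_mul]
  have hmint : IntegrableOn m (Ioi s) := by
    refine hint.mono' hm ?_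
    filter_upwards [ae_restrict_mem measurableSet_Ioi] with y hy
    have : 1 ≤ Real.exp (c * (y - s)) :=
      Real.one_le_exp (mul_nonneg hc.le (sub_nonneg.2 (le_of_lt hy)))
    nlinarith [norm_nonneg (m y)]
  have hz := ae_eq_zero_of_integral_exp_mul_eq_zero (m := (Ioi s).indicator m)
    ((integrable_indicator_iff measurableSet_Ioi).2 hmint) fun τ => ?_
  · rw [EventuallyEq, ae_restrict_iff' measurableSet_Ioi]
    filter_upwards [hz] with y hy hys
    rwa [indicator_of_mem hys] at hy
  · obtain ⟨n, hn⟩ := exists_nat_gt (|τ| / (c / 2))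
    have hn0 : (0 : ℝ) < n := lt_of_le_of_lt (by positivity) hn
    have hn' : |τ / n| ≤ c / 2 := by
      rw [abs_div, abs_of_pos hn0, div_le_iff₀ hn0]
      rw [div_lt_iff₀ (by positivity)] at hn
      linarith
    have h := hall (τ / n) hn' n 0
    rw [mul_div_cancel₀ _ hn0.ne'] at h
    have e : ∀ y : ℝ, Complex.exp (Complex.I * τ * y) * (Ioi s).indicator m y =
        (Ioi s).indicator (fun y : ℝ => Complex.exp (Complex.I * τ * s) *
          (((y - s : ℝ) : ℂ) ^ 0 *
            (Complex.exp (Complex.I * τ * ((y - s : ℝ) : ℂ)) * m y))) y := fun y => by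
      by_cases hy : y ∈ Ioi s
      · rw [indicator_of_mem hy, indicator_of_mem hy, pow_zero, one_mul, ← mul_assoc,
          ← Complex.exp_add]
        push_cast
        ring_nf
      · rw [indicator_of_notMem hy, indicator_of_notMem hy, mul_zero]
    simp only [e]
    rw [integral_indicator measurableSet_Ioi, integral_const_mul, h, mul_zero]

/-- On an open set where Hf vanishes its second derivative vanishes too, and `airyHankel_two`
isolates the remaining term. Iteration produces all moments. -/
theorem airyHankel_sub_mul_eq_zero (hf : Subexp s f)
    (h : ∀ x, s < x → airyHankel lam s 0 f x = 0) :
    ∀ x, s < x → airyHankel lam s 0 (fun y => ((y - s : ℝ) : ℂ) * f y) x = 0 := by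
  have hstep : ∀ n, (∀ x, s < x → airyHankel lam s n f x = 0) →
      ∀ x, s < x → airyHankel lam s (n + 1) f x = 0 := fun n hn x hx => by
    rw [← (hasDerivAt_airyHankel hf lam n x).deriv]
    have : airyHankel lam s n f =ᶠ[𝓝 x] fun _ => 0 := by
      filter_upwards [Ioi_mem_nhds hx] with y hy using hn y hy
    rw [this.deriv_eq, deriv_const]
  intro x hx
  have h2 := airyHankel_two (lam := lam) hf x
  rwa [hstep 1 (hstep 0 h) x hx, h x hx, mul_zero, zero_add, eq_comm] at h2

theorem ae_eq_zero_of_airyHankel_eq_zero (hlam : 0 < lam) (hf : Subexp s f)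
    (h : ∀ᵐ x ∂(volume.restrict (Ioi s)), airyHankel lam s 0 f x = 0) :
    f =ᵐ[volume.restrict (Ioi s)] 0 := by
  have h0 : ∀ x, s < x → airyHankel lam s 0 f x = 0 := by
    exact Measure.eqOn_open_of_ae_eq h isOpen_Ioi (continuous_airyHankel hf lam 0).continuousOn
      continuousOn_const
  have hmom : ∀ k : ℕ, Subexp s (fun y => ((y - s : ℝ) : ℂ) ^ k * f y) ∧ ∀ x, s < x →
      airyHankel lam s 0 (fun y => ((y - s : ℝ) : ℂ) ^ k * f y) x = 0 := by
    intro k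
    induction k with
    | zero => simpa using ⟨hf, h0⟩
    | succ k ih =>
      have := And.intro (ih.1.sub_mul s) (airyHankel_sub_mul_eq_zero ih.1 ih.2)
      simpa only [pow_succ', mul_assoc] using this
  -- Any x > s with x ≥ 0 would do: then x + y - s > 0 for y > s, where A has no zero.
  set x := |s| + 1
  have hx : s < x := by linarith [le_abs_self s, show x = |s| + 1 from rfl]
  have hx0 : 0 ≤ x := by positivity
  obtain ⟨C, hC, hb⟩ := exists_norm_airyDer_shift_le lam s 0
  have hz := ae_eq_zero_of_moments_eq_zero (s := s) (c := 1 / 2) (by norm_num)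
    (m := fun y => (airyDer lam 0 (x + y - s) : ℂ) * f y)
    ((continuous_airyDer_shift lam s 0 x).aestronglyMeasurable.mul hf.aestronglyMeasurable)
    ?_ fun k => ?_
  · filter_upwards [hz, ae_restrict_mem measurableSet_Ioi] with y hy hys
    have : airyDer lam 0 (x + y - s) ≠ 0 :=
      airyDer_zero_ne_zero hlam (by linarith [show s < y from hys])
    simpa [this] using hy
  · refine ((hf.integrableOn_exp_mul_norm (c := 1 / 2) (by norm_num)).const_mul
      (C * Real.exp (-x) * Real.exp (-(1 / 2) * s))).mono' ((Continuous.aestronglyMeasurable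
      (by fun_prop)).mul ((continuous_airyDer_shift lam s 0 x).aestronglyMeasurable.mul
        hf.aestronglyMeasurable).norm) (ae_of_all _ fun y => ?_)
    rw [norm_mul, norm_norm, norm_mul, Real.norm_eq_abs, Real.abs_exp]
    calc _ ≤ Real.exp (1 / 2 * (y - s)) * (C * Real.exp (-x) * Real.exp (-y) * ‖f y‖) := by
          gcongr
          exact hb x y
      _ = _ := by
          rw [show Real.exp (1 / 2 * (y - s)) = Real.exp (1 / 2 * y) * Real.exp (-(1 / 2) * s) by
            rw [← Real.exp_add]; ring_nf,
            show Real.exp (-(1 / 2) * y) = Real.exp (1 / 2 * y) * Real.exp (-y) by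
            rw [← Real.exp_add]; ring_nf]
          ring
  · rw [← (hmom k).2 x hx, airyHankel]
    congr 1
    funext y
    ring

/-! ### Integration by parts for the Hankel operator -/

theorem integral_Ioi_eq_zero_of_tendsto_zero {u u' : ℝ → ℂ}
    (hd : ∀ y ∈ Ioi s, HasDerivAt u (u' y) y) (hi : IntegrableOn u' (Ioi s)) {l : ℂ}
    (h0 : Tendsto u (𝓝[>] s) (𝓝 l)) (h1 : Tendsto u atTop (𝓝 0)) :
    ∫ y in Ioi s, u' y = -l := by
  have h := integral_Ioi_deriv_mul_eq_sub (u := u) (v := fun _ => 1) (u' := u')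
    (v' := fun _ => 0) (a' := l) (b' := 0) hd (fun x _ => hasDerivAt_const x (1 : ℂ))
  simp only [mul_one, mul_zero, add_zero, zero_sub] at h
  refine h (hi.congr (ae_of_all _ fun y => ?_)) (h0.congr fun y => ?_) (h1.congr fun y => ?_)
  · simp
  · simp
  · simp

theorem hasDerivAt_airyDer_shift (lam s : ℝ) (n : ℕ) (x y : ℝ) :
    HasDerivAt (fun y => (airyDer lam n (x + y - s) : ℂ))
      (airyDer lam (n + 1) (x + y - s) : ℂ) y := by
  have h0 : HasDerivAt (fun z : ℝ => x + z - s) 1 y :=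
    ((hasDerivAt_id y).const_add x).sub_const s
  have h1 := (hasDerivAt_airyDer lam n (x + y - s)).comp y h0
  rw [mul_one] at h1
  exact h1.ofReal_comp

theorem tendsto_airyDer_shift_mul (lam s : ℝ) (n : ℕ) (x : ℝ) {u : ℝ → ℂ}
    (hu : Tendsto (fun y => (Real.exp (-y) : ℂ) * u y) atTop (𝓝 0)) :
    Tendsto (fun y => (airyDer lam n (x + y - s) : ℂ) * u y) atTop (𝓝 0) := by
  obtain ⟨C, -, h⟩ := exists_norm_airyDer_shift_le lam s n
  refine squeeze_zero_norm (a := fun y => C * Real.exp (-x) * ‖(Real.exp (-y) : ℂ) * u y‖)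
    (fun y => ?_) (by simpa using hu.norm.const_mul (C * Real.exp (-x)))
  rw [norm_mul, norm_mul, Complex.norm_real (Real.exp _), Real.norm_eq_abs, Real.abs_exp,
    ← mul_assoc]
  exact mul_le_mul_of_nonneg_right (h x y) (norm_nonneg _)

theorem airyHankel_one_eq {u u' : ℝ → ℂ} (hd : ∀ y, HasDerivAt u (u' y) y) (hu : Subexp s u)
    (hu' : Subexp s u') (hinf : Tendsto (fun y => (Real.exp (-y) : ℂ) * u y) atTop (𝓝 0))
    (lam x : ℝ) :
    airyHankel lam s 1 u x = -(airyDer lam 0 x * u s) - airyHankel lam s 0 u' x := by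
  have hi1 := hu.integrableOn_airyDer_mul lam 1 x
  have hi2 := hu'.integrableOn_airyDer_mul lam 0 x
  have hW := fun y : ℝ => (hasDerivAt_airyDer_shift lam s 0 x y).mul (hd y)
  have h := integral_Ioi_eq_zero_of_tendsto_zero (s := s) (fun y _ => hW y) (hi1.add hi2)
    ((hW s).continuousAt.tendsto.mono_left nhdsWithin_le_nhds)
    (tendsto_airyDer_shift_mul lam s 0 x hinf)
  rw [integral_add hi1 hi2] at h
  simp only [Pi.mul_apply, add_sub_cancel_right] at h
  rw [airyHankel, airyHankel, ← h]
  ring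

/-- The Hankel operator commutes with the differential operator
`f ↦ ((x - s) f')' - x (x - s) f`. -/
theorem airyHankel_diff_comm {f' r : ℝ → ℂ} (hf : Subexp s f) (hr : Subexp s r)
    (hd : ∀ y ∈ Ioi s, HasDerivAt f (f' y) y)
    (hd' : ∀ y ∈ Ioi s, HasDerivAt (fun y : ℝ => ((y - s : ℝ) : ℂ) * f' y)
      (r y + ((y * (y - s) : ℝ) : ℂ) * f y) y)
    (h0 : Tendsto (fun y : ℝ => ((y - s : ℝ) : ℂ) * f' y) (𝓝[>] s) (𝓝 0))
    (h0' : Tendsto (fun y : ℝ => ((y - s : ℝ) : ℂ) * f y) (𝓝[>] s) (𝓝 0))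
    (h1 : Tendsto (fun y : ℝ => (Real.exp (-y) : ℂ) * (((y - s : ℝ) : ℂ) * f' y)) atTop (𝓝 0))
    (h1' : Tendsto (fun y : ℝ => (Real.exp (-y) : ℂ) * (((y - s : ℝ) : ℂ) * f y)) atTop (𝓝 0))
    (lam x : ℝ) :
    airyHankel lam s 0 r x = ((x - s : ℝ) : ℂ) * airyHankel lam s 2 f x +
      airyHankel lam s 1 f x - ((x * (x - s) : ℝ) : ℂ) * airyHankel lam s 0 f x := by
  have hi1 := hr.integrableOn_airyDer_mul lam 0 x
  have hi2 := hf.integrableOn_airyDer_mul lam 1 x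
  have hi3 := ((hf.sub_mul s).integrableOn_airyDer_mul lam 0 x).const_mul ((x - s : ℝ) : ℂ)
  have hlin : ∀ y : ℝ, HasDerivAt (fun y : ℝ => ((y - s : ℝ) : ℂ)) 1 y := fun y =>
    ((hasDerivAt_id y).sub_const s).ofReal_comp
  -- Green's identity: the bracket (y - s)(A f' - A' f) has zero limits at both ends, and the Airy
  -- equation simplifies its derivative.
  have hW : ∀ y ∈ Ioi s, HasDerivAt (fun y : ℝ =>
      (airyDer lam 0 (x + y - s) : ℂ) * (((y - s : ℝ) : ℂ) * f' y) -
        (airyDer lam 1 (x + y - s) : ℂ) * (((y - s : ℝ) : ℂ) * f y))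
      ((airyDer lam 0 (x + y - s) : ℂ) * r y - (airyDer lam 1 (x + y - s) : ℂ) * f y -
        ((x - s : ℝ) : ℂ) * ((airyDer lam 0 (x + y - s) : ℂ) * (((y - s : ℝ) : ℂ) * f y))) y := by
    intro y hy
    refine (((hasDerivAt_airyDer_shift lam s 0 x y).mul (hd' y hy)).sub
      ((hasDerivAt_airyDer_shift lam s 1 x y).mul ((hlin y).mul (hd y hy)))).congr_deriv ?_
    simp only [zero_add, Nat.reduceAdd, airyDer_two, Pi.mul_apply]
    push_cast
    ring
  have hlim : ∀ n, Tendsto (fun y => (airyDer lam n (x + y - s) : ℂ)) (𝓝[>] s)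
      (𝓝 (airyDer lam n (x + s - s) : ℂ)) := fun n =>
    (continuous_airyDer_shift lam s n x).continuousAt.tendsto.mono_left nhdsWithin_le_nhds
  have hinf := (tendsto_airyDer_shift_mul lam s 0 x h1).sub
    (tendsto_airyDer_shift_mul lam s 1 x h1')
  have h := integral_Ioi_eq_zero_of_tendsto_zero (l := 0) hW ((hi1.sub hi2).sub hi3)
    (by simpa using ((hlim 0).mul h0).sub ((hlim 1).mul h0'))
    (by simpa using hinf)
  have e := integral_sub (hi1.sub hi2) hi3
  simp only [Pi.sub_apply] at e
  rw [e, integral_sub hi1 hi2, integral_const_mul, neg_zero] at h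
  rw [airyHankel_two hf]
  simp only [airyHankel] at h ⊢
  push_cast at h ⊢
  linear_combination h

theorem tendsto_exp_neg_mul_sub (s : ℝ) :
    Tendsto (fun y : ℝ => (Real.exp (-y) : ℂ) * ((y - s : ℝ) : ℂ)) atTop (𝓝 0) := by
  have h1 : Tendsto (fun y : ℝ => y * Real.exp (-y)) atTop (𝓝 0) := by
    simpa using Real.tendsto_pow_mul_exp_neg_atTop_nhds_zero 1
  have h2 : Tendsto (fun y : ℝ => y * Real.exp (-y) - s * Real.exp (-y)) atTop (𝓝 0) := by
    simpa using h1.sub (Real.tendsto_exp_neg_atTop_nhds_zero.const_mul s)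
  have h3 := (Complex.continuous_ofReal.tendsto 0).comp h2
  refine h3.congr fun y => ?_
  simp only [Function.comp_apply]
  push_cast
  ring

theorem tendsto_airyHankel_atTop (hf : Subexp s f) (lam : ℝ) (n : ℕ) :
    Tendsto (airyHankel lam s n f) atTop (𝓝 0) := by
  obtain ⟨C, -, h⟩ := exists_norm_airyHankel_le lam s n
  refine squeeze_zero_norm (h f hf) ?_
  simpa using Real.tendsto_exp_neg_atTop_nhds_zero.const_mul (C * expNorm s f)

/-! ### Eigenfunctions of the Hankel operator -/

/-- `f` satisfies `∫ A (x + y - s) f y dy = μ f x` for all real `x`. -/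
structure IsHankelEigen (lam s : ℝ) (f : ℝ → ℂ) (μ : ℂ) : Prop where
  subexp : Subexp s f
  eigen : ∀ x, airyHankel lam s 0 f x = μ * f x

namespace IsHankelEigen

variable {μ : ℂ}

theorem sub (hf : IsHankelEigen lam s f μ) (hg : IsHankelEigen lam s g μ) (a b : ℂ) :
    IsHankelEigen lam s (fun x => a * f x - b * g x) μ := by
  refine ⟨(hf.subexp.const_mul a).sub (hg.subexp.const_mul b), fun x => ?_⟩
  have := airyHankel_add (lam := lam) (hf.subexp.const_mul a) (hg.subexp.const_mul (-b)) 0 x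
  rw [airyHankel_const_mul, airyHankel_const_mul, hf.eigen, hg.eigen] at this
  simp only [neg_mul, ← sub_eq_add_neg] at this
  rw [this]
  ring

theorem eq_hankel (hf : IsHankelEigen lam s f μ) (hμ : μ ≠ 0) :
    f = fun x => μ⁻¹ * airyHankel lam s 0 f x := by
  funext x
  rw [hf.eigen, inv_mul_cancel_left₀ hμ]

theorem hasDerivAt (hf : IsHankelEigen lam s f μ) (hμ : μ ≠ 0) (x : ℝ) :
    HasDerivAt f (μ⁻¹ * airyHankel lam s 1 f x) x := by
  have h := (hasDerivAt_airyHankel hf.subexp lam 0 x).const_mul μ⁻¹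
  rwa [← hf.eq_hankel hμ] at h

theorem tendsto_atTop (hf : IsHankelEigen lam s f μ) (hμ : μ ≠ 0) : Tendsto f atTop (𝓝 0) := by
  rw [hf.eq_hankel hμ]
  simpa using (tendsto_airyHankel_atTop hf.subexp lam 0).const_mul μ⁻¹

theorem eq_zero (hf : IsHankelEigen lam s f μ) (hμ : μ ≠ 0) (h : ∀ x, s < x → f x = 0) :
    ∀ x, f x = 0 := by
  intro x
  have h0 : airyHankel lam s 0 f x = 0 := by
    rw [airyHankel]
    refine (setIntegral_congr_fun measurableSet_Ioi fun y hy => ?_).trans (integral_zero _ _)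
    simp [h y hy]
  rw [hf.eq_hankel hμ]
  simp only [h0, mul_zero]

/-- The kernel has equal x- and y-derivatives, so integration by parts flips the sign of the
eigenvalue, up to an end point term. -/
theorem hankel_deriv (hf : IsHankelEigen lam s f μ) (hμ : μ ≠ 0) (x : ℝ) :
    airyHankel lam s 0 (fun x => μ⁻¹ * airyHankel lam s 1 f x) x =
      -(airyDer lam 0 x * f s) + -μ * (μ⁻¹ * airyHankel lam s 1 f x) := by
  have h := airyHankel_one_eq (hf.hasDerivAt hμ) hf.subexp
    ((subexp_airyHankel hf.subexp lam 1 s).const_mul μ⁻¹) ?_ lam x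
  · rw [neg_mul, mul_inv_cancel_left₀ hμ]
    linear_combination h
  · have := Real.tendsto_exp_neg_atTop_nhds_zero.ofReal
    simpa using this.mul (hf.tendsto_atTop hμ)

theorem deriv (hf : IsHankelEigen lam s f μ) (hμ : μ ≠ 0) (h0 : f s = 0) :
    IsHankelEigen lam s (fun x => μ⁻¹ * airyHankel lam s 1 f x) (-μ) := by
  refine ⟨(subexp_airyHankel hf.subexp lam 1 s).const_mul μ⁻¹, fun x => ?_⟩
  rw [hf.hankel_deriv hμ, h0, mul_zero, neg_zero, zero_add]

/-- Eigenfunctions for opposite eigenvalues cannot both be nonzero at the end point. -/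
theorem mul_eq_zero (hf : IsHankelEigen lam s f μ) (hg : IsHankelEigen lam s g (-μ))
    (hμ : μ ≠ 0) : f s * g s = 0 := by
  have hs := (subexp_airyHankel hf.subexp lam 1 s).const_mul μ⁻¹
  -- Pairing f' with g: the terms -μ ∫ f' g on the two sides cancel, leaving f(s) (Hg)(s) = -μ f(s)
  -- g(s) = 0.
  have h := integral_airyHankel_mul (lam := lam) hs hg.subexp 0
  have hi1 : IntegrableOn (fun x => (airyDer lam 0 (s + x - s) : ℂ) * g x) (Ioi s) :=
    hg.subexp.integrableOn_airyDer_mul lam 0 s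
  have hi2 : IntegrableOn (fun x => μ⁻¹ * airyHankel lam s 1 f x * g x) (Ioi s) := by
    obtain ⟨C, -, hb⟩ := exists_norm_airyHankel_le lam s 1
    refine hg.subexp.integrableOn_mul ((continuous_airyHankel hf.subexp lam 1).const_mul μ⁻¹)
      one_pos (C := ‖μ⁻¹‖ * (C * expNorm s f)) fun y _ => ?_
    rw [norm_mul, neg_one_mul, mul_assoc]
    exact mul_le_mul_of_nonneg_left (hb f hf.subexp y) (norm_nonneg _)
  have e1 : ∀ x, airyHankel lam s 0 (fun x => μ⁻¹ * airyHankel lam s 1 f x) x * g x =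
      -f s * ((airyDer lam 0 (s + x - s) : ℂ) * g x) +
        -μ * (μ⁻¹ * airyHankel lam s 1 f x * g x) := fun x => by
    rw [hf.hankel_deriv hμ, add_sub_cancel_left]
    ring
  have e2 : ∀ x, μ⁻¹ * airyHankel lam s 1 f x * airyHankel lam s 0 g x =
      -μ * (μ⁻¹ * airyHankel lam s 1 f x * g x) := fun x => by
    rw [hg.eigen]
    ring
  simp only [e1, e2] at h
  rw [integral_add (hi1.const_mul _) (hi2.const_mul _), integral_const_mul,
    add_eq_right] at h
  have h3 := hg.eigen s
  rw [airyHankel] at h3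
  rw [h3] at h
  have : μ * (f s * g s) = 0 := by linear_combination h
  exact (_root_.mul_eq_zero.1 this).resolve_left hμ

/-- The function is Lf, with f' and f'' written through the Hankel operator. At x = s only the term
f'(s) survives. -/
theorem diff (hf : IsHankelEigen lam s f μ) (hμ : μ ≠ 0) :
    IsHankelEigen lam s (fun x => ((x - s : ℝ) : ℂ) * (μ⁻¹ * airyHankel lam s 2 f x) +
      μ⁻¹ * airyHankel lam s 1 f x - (x : ℂ) * (((x - s : ℝ) : ℂ) * f x)) μ := by
  have hs1 := (subexp_airyHankel hf.subexp lam 1 s).const_mul μ⁻¹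
  have hs2 := (subexp_airyHankel hf.subexp lam 2 s).const_mul μ⁻¹
  have hr := ((hs2.sub_mul s).add hs1).sub (hf.subexp.sub_mul s).id_mul
  refine ⟨hr, fun x => ?_⟩
  have hlin : ∀ y : ℝ, HasDerivAt (fun y : ℝ => ((y - s : ℝ) : ℂ)) 1 y := fun y =>
    ((hasDerivAt_id y).sub_const s).ofReal_comp
  have hd1 := fun y => (hasDerivAt_airyHankel hf.subexp lam 1 y).const_mul μ⁻¹
  have hW : ∀ y, HasDerivAt
      (fun y : ℝ => ((y - s : ℝ) : ℂ) * (μ⁻¹ * airyHankel lam s 1 f y)) _ y :=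
    fun y => (hlin y).mul (hd1 y)
  have hV : ∀ y, HasDerivAt (fun y : ℝ => ((y - s : ℝ) : ℂ) * f y) _ y :=
    fun y => (hlin y).mul (hf.hasDerivAt hμ y)
  rw [airyHankel_diff_comm hf.subexp hr (fun y _ => hf.hasDerivAt hμ y)
    (fun y _ => (hW y).congr_deriv ?_) ?_ ?_ ?_ ?_ lam x, hf.eigen]
  · push_cast
    field_simp
  · have := (hW s).continuousAt.tendsto.mono_left (nhdsWithin_le_nhds (s := Ioi s))
    simpa using this
  · have := (hV s).continuousAt.tendsto.mono_left (nhdsWithin_le_nhds (s := Ioi s))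
    simpa using this
  · simp only [← mul_assoc]
    simpa using ((tendsto_exp_neg_mul_sub s).mul_const μ⁻¹).mul
      (tendsto_airyHankel_atTop hf.subexp lam 1)
  · simp only [← mul_assoc]
    simpa using (tendsto_exp_neg_mul_sub s).mul (hf.tendsto_atTop hμ)
  · push_cast
    ring

end IsHankelEigen

/-! ### Simplicity of the eigenvalues of the Airy kernel -/

theorem norm_le_pow_succ_div_factorial {u u' : ℝ → ℂ} {K : ℝ} {n : ℕ}
    (hd : ∀ y, HasDerivAt u (u' y) y) (h0 : u s = 0)
    (hb : ∀ y, s ≤ y → ‖u' y‖ ≤ K * (y - s) ^ n / n.factorial) :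
    ∀ y, s ≤ y → ‖u y‖ ≤ K * (y - s) ^ (n + 1) / (n + 1).factorial := by
  intro y hy
  refine image_norm_le_of_norm_deriv_right_le_deriv_boundary (a := s) (b := y) (f := u) (f' := u')
    (B := fun y => K * (y - s) ^ (n + 1) / (n + 1).factorial)
    (B' := fun y => K * (y - s) ^ n / n.factorial)
    (fun z _ => (hd z).continuousAt.continuousWithinAt) (fun z _ => (hd z).hasDerivWithinAt)
    (by simp [h0]) (fun z => ?_) (fun z hz => hb z hz.1) ⟨hy, le_rfl⟩
  have h1 : HasDerivAt (fun y : ℝ => y - s) 1 z := (hasDerivAt_id z).sub_const s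
  refine (((h1.pow (n + 1)).const_mul K).div_const _).congr_deriv ?_
  rw [Nat.factorial_succ]
  have : (n.factorial : ℝ) ≠ 0 := by positivity
  push_cast
  field_simp

namespace IsHankelEigen

variable {μ : ℂ}

/-- Two sign flips; f(s) = 0 and f'(s) = 0 remove the end point terms. -/
theorem deriv_two (hf : IsHankelEigen lam s f μ) (hμ : μ ≠ 0) (h0 : f s = 0)
    (h1 : airyHankel lam s 1 f s = 0) :
    IsHankelEigen lam s (fun x => μ⁻¹ * airyHankel lam s 2 f x) μ := by
  have hd := hf.deriv hμ h0
  have hd2 := hd.deriv (neg_ne_zero.2 hμ) (by simp [h1])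
  have e : (fun x => (-μ)⁻¹ * airyHankel lam s 1 (fun x => μ⁻¹ * airyHankel lam s 1 f x) x) =
      fun x => μ⁻¹ * airyHankel lam s 2 f x := by
    funext x
    exact (hd.hasDerivAt (neg_ne_zero.2 hμ) x).unique
      ((hasDerivAt_airyHankel hf.subexp lam 1 x).const_mul μ⁻¹)
  rwa [e, neg_neg] at hd2

/-- An eigenspace all of whose elements vanish at the end point is trivial. -/
theorem eq_zero_of_forall_eq_zero (hμ : μ ≠ 0)
    (hall : ∀ g, IsHankelEigen lam s g μ → g s = 0) (hf : IsHankelEigen lam s f μ) :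
    ∀ x, f x = 0 := by
  have hone : ∀ g, IsHankelEigen lam s g μ → airyHankel lam s 1 g s = 0 := fun g hg => by
    have := hall _ (hg.diff hμ)
    simpa [hμ] using this
  obtain ⟨C₀, hC₀, hb₀⟩ := exists_norm_airyHankel_le lam s 0
  obtain ⟨C₂, hC₂, hb₂⟩ := exists_norm_airyHankel_le lam s 2
  set I : ℝ := ∫ y in Ioi s, Real.exp (-2 * y) with hI
  have hI0 : 0 ≤ I := integral_nonneg fun y => by positivity
  -- r² bounds g ↦ g'' in `expNorm`; the root makes the bounds below even-indexed terms of z^n / n!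
  -- with z = r(x - s).
  set r : ℝ := Real.sqrt (‖μ⁻¹‖ * C₂ * I) with hr
  have hr2 : r ^ 2 = ‖μ⁻¹‖ * C₂ * I := Real.sq_sqrt (by positivity)
  set B : ℝ := ‖μ⁻¹‖ * C₀ * Real.exp (-s) with hB
  have hB0 : 0 ≤ B := by positivity
  have hnorm : ∀ g, IsHankelEigen lam s g μ →
      expNorm s (fun x => μ⁻¹ * airyHankel lam s 2 g x) ≤ r ^ 2 * expNorm s g := by
    intro g hg
    have hint := (exp_neg_integrableOn_Ioi s two_pos).const_mul (‖μ⁻¹‖ * (C₂ * expNorm s g))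
    calc _ ≤ ∫ y in Ioi s, ‖μ⁻¹‖ * (C₂ * expNorm s g) * Real.exp (-2 * y) := by
          refine integral_mono_of_nonneg (ae_of_all _ fun y => by positivity) hint
            (ae_of_all _ fun y => ?_)
          have := hb₂ g hg.subexp y
          dsimp only
          rw [norm_mul]
          calc _ ≤ Real.exp (-y) * (‖μ⁻¹‖ * (C₂ * expNorm s g * Real.exp (-y))) := by gcongr
            _ = _ := by
              rw [show -2 * y = -y + -y by ring, Real.exp_add]
              ring
      _ = r ^ 2 * expNorm s g := by
          rw [integral_const_mul, hr2]
          ring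
  -- The bound is quantified over all g in order to be applied to g'', and is then integrated twice
  -- from s, where g and g' vanish.
  have key : ∀ n : ℕ, ∀ g, IsHankelEigen lam s g μ → ∀ x, s ≤ x →
      ‖g x‖ ≤ B * expNorm s g * r ^ (2 * n) * (x - s) ^ (2 * n) / (2 * n).factorial := by
    intro n
    induction n with
    | zero =>
      intro g hg x hx
      have h := hb₀ g hg.subexp x
      rw [hg.eq_hankel hμ]
      simp only [norm_mul, mul_zero, pow_zero, mul_one, Nat.factorial_zero, Nat.cast_one, div_one]
      rw [← hg.eq_hankel hμ]
      have hn := expNorm_nonneg (s := s) (f := g)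
      calc _ ≤ ‖μ⁻¹‖ * (C₀ * expNorm s g * Real.exp (-s)) := by
            refine mul_le_mul_of_nonneg_left (h.trans ?_) (norm_nonneg _)
            gcongr
        _ = _ := by
            rw [hB]
            ring
    | succ n ih =>
      intro g hg x hx
      have h2 := hg.deriv_two hμ (hall g hg) (hone g hg)
      refine norm_le_pow_succ_div_factorial (n := 2 * n + 1) (hg.hasDerivAt hμ) (hall g hg)
        (norm_le_pow_succ_div_factorial (n := 2 * n)
          (fun y => (hasDerivAt_airyHankel hg.subexp lam 1 y).const_mul μ⁻¹)
          (by simp [hone g hg]) fun y hy => (ih _ h2 y hy).trans ?_) x hx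
      have hy' : 0 ≤ y - s := sub_nonneg.2 hy
      have hn := hnorm g hg
      refine div_le_div_of_nonneg_right (mul_le_mul_of_nonneg_right ?_ (by positivity))
        (by positivity)
      calc _ ≤ B * (r ^ 2 * expNorm s g) * r ^ (2 * n) := by gcongr
        _ = _ := by ring
  refine hf.eq_zero hμ fun x hx => norm_le_zero_iff.1 ?_
  have hlim := ((FloorSemiring.tendsto_pow_div_factorial_atTop (r * (x - s))).comp
    (tendsto_id.const_mul_atTop' (two_pos : 0 < 2))).const_mul (B * expNorm s f)
  rw [mul_zero] at hlim
  refine ge_of_tendsto' hlim fun n => (key n f hf x hx.le).trans_eq ?_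
  simp only [Function.comp_apply, id, mul_pow]
  ring

theorem eq_zero_of_eq_zero_at_endpoint (hμ : μ ≠ 0)
    (htriv : ∀ g, IsHankelEigen lam s g (-μ) → ∀ x, g x = 0) (hf : IsHankelEigen lam s f μ)
    (h0 : f s = 0) : ∀ x, f x = 0 := by
  intro x
  have hd := htriv _ (hf.deriv hμ h0)
  have := is_const_of_deriv_eq_zero (fun y => (hf.hasDerivAt hμ y).differentiableAt)
    (fun y => (hf.hasDerivAt hμ y).deriv.trans (hd y)) x s
  rw [this, h0]

theorem eq_const_mul (hμ : μ ≠ 0)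
    (htriv : ∀ g, IsHankelEigen lam s g (-μ) → ∀ x, g x = 0) (hf : IsHankelEigen lam s f μ)
    (hf0 : ∃ x, f x ≠ 0) (hg : IsHankelEigen lam s g μ) : ∃ c : ℂ, ∀ x, g x = c * f x := by
  have hs : f s ≠ 0 := fun h0 => by
    obtain ⟨x, hx⟩ := hf0
    exact hx (hf.eq_zero_of_eq_zero_at_endpoint hμ htriv h0 x)
  refine ⟨g s / f s, fun x => ?_⟩
  have h := (hg.sub hf (f s) (g s)).eq_zero_of_eq_zero_at_endpoint hμ htriv (by ring) x
  field_simp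
  linear_combination h

/-- The sign of the root is chosen so that the eigenspace whose elements all vanish at s belongs to
-μ. -/
theorem exists_sq_eq_and_forall_eq_zero (lam s : ℝ) {κ : ℂ} (hκ : κ ≠ 0) :
    ∃ μ : ℂ, μ ≠ 0 ∧ μ ^ 2 = κ ∧ ∀ g, IsHankelEigen lam s g (-μ) → ∀ x, g x = 0 := by
  obtain ⟨μ, hμ⟩ := IsAlgClosed.exists_pow_nat_eq κ two_pos
  have hμ0 : μ ≠ 0 := by
    rintro rfl
    exact hκ (by simpa using hμ.symm)
  by_cases h : ∀ g, IsHankelEigen lam s g μ → g s = 0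
  · refine ⟨-μ, neg_ne_zero.2 hμ0, by rw [neg_sq, hμ], fun g hg => ?_⟩
    rw [neg_neg] at hg
    exact eq_zero_of_forall_eq_zero hμ0 h hg
  · push Not at h
    obtain ⟨g₁, hg₁, hg₁s⟩ := h
    exact ⟨μ, hμ0, hμ, fun g hg => eq_zero_of_forall_eq_zero (neg_ne_zero.2 hμ0)
      (fun g hg => (_root_.mul_eq_zero.1 (hg₁.mul_eq_zero hg hμ0)).resolve_left hg₁s) hg⟩

end IsHankelEigen

/-! ### From the Airy kernel to the Hankel operator -/

theorem IsAiryEigenfunction.ne_zero_eigenvalue (hlam : 0 < lam) {κ : ℂ}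
    (hf : IsAiryEigenfunction lam s f κ) : κ ≠ 0 := by
  rintro rfl
  have hs := subexp_of_memLp hf.memLp
  have h := hf.eigen
  simp only [integral_airyKernel_mul hs, zero_mul] at h
  exact hf.ne_zero (ae_eq_zero_of_airyHankel_eq_zero hlam hs
    (ae_eq_zero_of_airyHankel_eq_zero hlam (subexp_airyHankel hs lam 0 s) h))

theorem IsAiryEigenfunction.exists_isHankelEigen {κ μ : ℂ} (hμ : μ ≠ 0) (hκ : μ ^ 2 = κ)
    (htriv : ∀ g, IsHankelEigen lam s g (-μ) → ∀ x, g x = 0)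
    (hf : IsAiryEigenfunction lam s f κ) :
    ∃ g, IsHankelEigen lam s g μ ∧ f =ᵐ[volume.restrict (Ioi s)] g := by
  have hs := subexp_of_memLp hf.memLp
  have hκ0 : κ ≠ 0 := hκ ▸ pow_ne_zero 2 hμ
  have hs1 := subexp_airyHankel hs lam 0 s
  have hs2 := subexp_airyHankel hs1 lam 0 s
  have h := hf.eigen
  simp only [integral_airyKernel_mul hs] at h
  -- The smooth representative of f, for which the eigenvalue equation holds at every real x.
  set g : ℝ → ℂ := fun x => κ⁻¹ * airyHankel lam s 0 (airyHankel lam s 0 f) x with hg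
  have hfg : f =ᵐ[volume.restrict (Ioi s)] g := h.mono fun x hx => by
    simp only [hg, hx, inv_mul_cancel_left₀ hκ0]
  have hsg : Subexp s g := hs2.const_mul _
  have h1 : airyHankel lam s 0 g = airyHankel lam s 0 f :=
    funext fun x => (airyHankel_congr hfg 0 x).symm
  have h2 : ∀ x, airyHankel lam s 0 (airyHankel lam s 0 g) x = κ * g x := fun x => by
    rw [h1, hg, mul_inv_cancel_left₀ hκ0]
  have hsg1 := subexp_airyHankel hsg lam 0 s
  refine ⟨g, ⟨hsg, fun x => ?_⟩, hfg⟩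
  -- The factorization (H + μ)(H - μ)g = 0.
  have hm : IsHankelEigen lam s (fun x => airyHankel lam s 0 g x + -μ * g x) (-μ) := by
    refine ⟨hsg1.add (hsg.const_mul _), fun x => ?_⟩
    rw [airyHankel_add hsg1 (hsg.const_mul _), airyHankel_const_mul, h2, ← hκ]
    ring
  linear_combination htriv _ hm x

theorem IsAiryEigenvalue.isSimple (hlam : 0 < lam) {κ : ℂ} (h : IsAiryEigenvalue lam s κ) :
    IsSimpleAiryEigenvalue lam s κ := by
  obtain ⟨f, hf⟩ := h
  refine ⟨f, hf, fun g hg => ?_⟩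
  obtain ⟨μ, hμ, hκ, htriv⟩ :=
    IsHankelEigen.exists_sq_eq_and_forall_eq_zero lam s (hf.ne_zero_eigenvalue hlam)
  obtain ⟨f', hf', hff'⟩ := hf.exists_isHankelEigen hμ hκ htriv
  obtain ⟨g', hg', hgg'⟩ := hg.exists_isHankelEigen hμ hκ htriv
  have hne : ∃ x, f' x ≠ 0 := by
    by_contra! h0
    exact hf.ne_zero (hff'.trans (ae_of_all _ h0))
  obtain ⟨c, hc⟩ := hf'.eq_const_mul hμ htriv hne hg'
  refine ⟨c, ?_⟩
  filter_upwards [hff', hgg'] with x hx hy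
  rw [hy, hc, hx]

/-! ### Eigenfunctions of the differential operator -/

/-- The weight exp(c(x - y)) is at least 1 for y ≤ x. Through such bounds the behaviour of f' at
infinity follows from the equation and square integrability of f alone. -/
theorem exists_norm_le_exp_of_subexp_deriv {b : ℝ} {u u' : ℝ → ℂ}
    (hd : ∀ y ∈ Ici b, HasDerivAt u (u' y) y) (hc : ContinuousOn u' (Ici b))
    (hu' : Subexp b u') {c : ℝ} (hc0 : 0 < c) :
    ∃ C : ℝ, ∀ x ∈ Ici b, ‖u x‖ ≤ C * Real.exp (c * x) := by
  have hi := hu'.integrableOn_exp_mul_norm hc0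
  refine ⟨‖u b‖ * Real.exp (-c * b) + ∫ y in Ioi b, Real.exp (-c * y) * ‖u' y‖, fun x hx => ?_⟩
  have hx' : b ≤ x := hx
  have hsub : uIcc b x ⊆ Ici b := by
    rw [uIcc_of_le hx']
    exact Icc_subset_Ici_self
  have h1 := intervalIntegral.integral_eq_sub_of_hasDerivAt (fun y hy => hd y (hsub hy))
    (hc.mono hsub).intervalIntegrable
  have h2 : ‖∫ y in b..x, u' y‖ ≤
      Real.exp (c * x) * ∫ y in Ioi b, Real.exp (-c * y) * ‖u' y‖ := by
    rw [intervalIntegral.integral_of_le hx', ← integral_const_mul]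
    calc _ ≤ ∫ y in Ioc b x, Real.exp (c * x) * (Real.exp (-c * y) * ‖u' y‖) := by
          refine norm_integral_le_of_norm_le
            ((hi.mono_set Ioc_subset_Ioi_self).const_mul _) ?_
          filter_upwards [ae_restrict_mem measurableSet_Ioc] with y hy
          rw [← mul_assoc, ← Real.exp_add]
          refine le_mul_of_one_le_left (norm_nonneg _) (Real.one_le_exp ?_)
          nlinarith [hy.2]
      _ ≤ _ := setIntegral_mono_set (hi.const_mul _) (ae_of_all _ fun y => by
          simp only [Pi.zero_apply]
          positivity) Ioc_subset_Ioi_self.eventuallyLE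
  have h3 : u x = u b + ∫ y in b..x, u' y := by
    rw [h1]
    ring
  have h4 : ‖u b‖ ≤ ‖u b‖ * Real.exp (-c * b) * Real.exp (c * x) := by
    rw [mul_assoc, ← Real.exp_add]
    refine le_mul_of_one_le_right (norm_nonneg _) (Real.one_le_exp ?_)
    nlinarith
  rw [h3, add_mul]
  refine (norm_add_le _ _).trans (add_le_add h4 (h2.trans_eq (mul_comm _ _)))

theorem subexp_of_subexp_deriv {b : ℝ} {u u' : ℝ → ℂ}
    (hd : ∀ y ∈ Ici b, HasDerivAt u (u' y) y) (hc : ContinuousOn u' (Ici b))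
    (hu' : Subexp b u') : Subexp b u := by
  intro c hc0
  obtain ⟨C, hC⟩ := exists_norm_le_exp_of_subexp_deriv hd hc hu' (half_pos hc0)
  have hcont : ContinuousOn u (Ioi b) := fun y hy =>
    (hd y (Ioi_subset_Ici_self hy)).continuousAt.continuousWithinAt
  have he : Continuous fun y : ℝ => (Real.exp (-c * y) : ℂ) := by fun_prop
  refine ((exp_neg_integrableOn_Ioi b (half_pos hc0)).const_mul C).mono'
    ((he.continuousOn.mul hcont).aestronglyMeasurable measurableSet_Ioi) ?_
  filter_upwards [ae_restrict_mem measurableSet_Ioi] with y hy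
  rw [norm_mul, Complex.norm_real, Real.norm_eq_abs, Real.abs_exp]
  calc _ ≤ Real.exp (-c * y) * (C * Real.exp (c / 2 * y)) :=
        mul_le_mul_of_nonneg_left (hC y (Ioi_subset_Ici_self hy)) (Real.exp_pos _).le
    _ = _ := by
        rw [mul_left_comm, ← Real.exp_add]
        ring_nf

theorem tendsto_exp_neg_mul_of_subexp_deriv {b : ℝ} {u u' : ℝ → ℂ}
    (hd : ∀ y ∈ Ici b, HasDerivAt u (u' y) y) (hc : ContinuousOn u' (Ici b))
    (hu' : Subexp b u') : Tendsto (fun y => (Real.exp (-y) : ℂ) * u y) atTop (𝓝 0) := by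
  obtain ⟨C, hC⟩ := exists_norm_le_exp_of_subexp_deriv hd hc hu' (half_pos one_pos)
  have hlim : Tendsto (fun y : ℝ => C * Real.exp (-(1 / 2 * y))) atTop (𝓝 0) := by
    simpa using (Real.tendsto_exp_neg_atTop_nhds_zero.comp
      (tendsto_id.const_mul_atTop (half_pos one_pos))).const_mul C
  refine squeeze_zero_norm' ?_ hlim
  filter_upwards [eventually_ge_atTop b] with y hy
  rw [norm_mul, Complex.norm_real, Real.norm_eq_abs, Real.abs_exp]
  calc _ ≤ Real.exp (-y) * (C * Real.exp (1 / 2 * y)) :=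
        mul_le_mul_of_nonneg_left (hC y hy) (Real.exp_pos _).le
    _ = _ := by
        rw [mul_left_comm, ← Real.exp_add]
        ring_nf

/-- Near s the mean value bound for f on [x, b] is at most (ε/2)/(x - s), as b ≤ s + 1; the factor x
- s then leaves ε/2 and a vanishing term. -/
theorem tendsto_sub_mul_of_tendsto_sub_mul_deriv {f' : ℝ → ℂ}
    (hd : ∀ y ∈ Ioi s, HasDerivAt f (f' y) y)
    (h : Tendsto (fun y : ℝ => ((y - s : ℝ) : ℂ) * f' y) (𝓝[>] s) (𝓝 0)) :
    Tendsto (fun y : ℝ => ((y - s : ℝ) : ℂ) * f y) (𝓝[>] s) (𝓝 0) := by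
  rw [Metric.tendsto_nhds] at h ⊢
  intro ε hε
  have h1 := h (ε / 2) (half_pos hε)
  obtain ⟨b, hb, hsub⟩ := mem_nhdsGT_iff_exists_Ioc_subset.1
    (inter_mem h1 (Ioc_mem_nhdsGT (lt_add_one s)))
  have hbs : s < b := hb
  have hb1 : b ≤ s + 1 := (hsub ⟨hbs, le_rfl⟩).2.2
  have h2 : Tendsto (fun y : ℝ => (y - s) * ‖f b‖) (𝓝[>] s) (𝓝 0) := by
    have : Continuous fun y : ℝ => (y - s) * ‖f b‖ := by fun_prop
    simpa using (this.tendsto s).mono_left (nhdsWithin_le_nhds (s := Ioi s))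
  filter_upwards [h2.eventually (gt_mem_nhds (half_pos hε)), Ioc_mem_nhdsGT hbs] with x hx hxb
  have hxs : 0 < x - s := sub_pos.2 hxb.1
  have hder : ∀ y ∈ Icc x b, ‖f' y‖ ≤ ε / 2 / (x - s) := fun y hy => by
    have hys : s < y := hxb.1.trans_le hy.1
    have := (hsub ⟨hys, hy.2⟩).1
    simp only [mem_ofPred_eq, dist_zero_right, norm_mul, Complex.norm_real, Real.norm_eq_abs,
      abs_of_pos (sub_pos.2 hys)] at this
    rw [le_div_iff₀ hxs]
    nlinarith [norm_nonneg (f' y), hy.1]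
  have hmv := (convex_Icc x b).norm_image_sub_le_of_norm_hasDerivWithin_le
    (fun y hy => (hd y (hxb.1.trans_le hy.1)).hasDerivWithinAt) hder
    (right_mem_Icc.2 hxb.2) (left_mem_Icc.2 hxb.2)
  have hfx : ‖f x‖ ≤ ‖f b‖ + ε / 2 / (x - s) * ‖x - b‖ := by
    calc ‖f x‖ = ‖f b + (f x - f b)‖ := by rw [add_sub_cancel]
      _ ≤ _ := (norm_add_le _ _).trans (by gcongr)
  have hxb1 : ‖x - b‖ ≤ 1 := by
    rw [Real.norm_eq_abs, abs_le]
    constructor <;> linarith [hxb.1, hxb.2]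
  rw [dist_zero_right, norm_mul, Complex.norm_real, Real.norm_eq_abs, abs_of_pos hxs]
  calc (x - s) * ‖f x‖ ≤ (x - s) * (‖f b‖ + ε / 2 / (x - s) * 1) := by
        refine mul_le_mul_of_nonneg_left (hfx.trans ?_) hxs.le
        gcongr
    _ = (x - s) * ‖f b‖ + ε / 2 := by field_simp
    _ < ε := by linarith

/-! ### Eigenfunctions of L are eigenfunctions of the Hankel operator -/

namespace IsDiffLEigenfunction

variable {ν : ℂ}

theorem hasDerivAt (hf : IsDiffLEigenfunction s f ν) {y : ℝ} (hy : y ∈ Ioi s) :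
    HasDerivAt f (deriv f y) y :=
  ((hf.contDiffOn.differentiableOn two_ne_zero).differentiableAt
    (isOpen_Ioi.mem_nhds hy)).hasDerivAt

theorem hasDerivAt_sub_mul_deriv (hf : IsDiffLEigenfunction s f ν) {y : ℝ} (hy : y ∈ Ioi s) :
    HasDerivAt (fun y : ℝ => ((y - s : ℝ) : ℂ) * deriv f y)
      (ν * f y + ((y * (y - s) : ℝ) : ℂ) * f y) y := by
  have h1 : DifferentiableAt ℝ (deriv f) y :=
    ((hf.contDiffOn.deriv_of_isOpen (m := 1) isOpen_Ioi (by norm_num)).differentiableOn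
      one_ne_zero).differentiableAt (isOpen_Ioi.mem_nhds hy)
  have h2 : DifferentiableAt ℝ (fun y : ℝ => ((y - s : ℝ) : ℂ)) y :=
    ((hasDerivAt_id y).sub_const s).ofReal_comp.differentiableAt
  refine (h2.mul h1).hasDerivAt.congr_deriv ?_
  rw [← hf.eigen y hy, diffL, sub_add_cancel]
  rfl

theorem airyHankel_eq (hf : IsDiffLEigenfunction s f ν) (lam x : ℝ) :
    ((x - s : ℝ) : ℂ) * airyHankel lam s 2 f x + airyHankel lam s 1 f x =
      (ν + ((x * (x - s) : ℝ) : ℂ)) * airyHankel lam s 0 f x := by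
  have hs := subexp_of_memLp hf.memLp
  have hss : s < s + 1 := lt_add_one s
  have hsub : Ici (s + 1) ⊆ Ioi s := fun y hy => hss.trans_le hy
  have hsub' : Ioi (s + 1) ⊆ Ioi s := Ioi_subset_Ioi hss.le
  have hcont : ContinuousOn f (Ioi s) := hf.contDiffOn.continuousOn
  have hs1 : Subexp s fun y => ν * f y + ((y * (y - s) : ℝ) : ℂ) * f y := by
    refine ((hs.const_mul ν).add (hs.sub_mul s).id_mul).congr (ae_of_all _ fun y => ?_)
    push_cast
    ring
  -- Growth at infinity is estimated on [s + 1, ∞), away from the singular end point: first for (y -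
  -- s)f', whose derivative involves f only, then for (y - s)f.
  have hp := fun y (hy : y ∈ Ici (s + 1)) => hf.hasDerivAt_sub_mul_deriv (hsub hy)
  have hpc : ContinuousOn (fun y => ν * f y + ((y * (y - s) : ℝ) : ℂ) * f y) (Ici (s + 1)) := by
    have hc : Continuous fun y : ℝ => ((y * (y - s) : ℝ) : ℂ) := by fun_prop
    exact (continuousOn_const.mul (hcont.mono hsub)).add
      (hc.continuousOn.mul (hcont.mono hsub))
  have hps : Subexp (s + 1) fun y => ν * f y + ((y * (y - s) : ℝ) : ℂ) * f y :=
    fun c hc => (hs1 c hc).mono_set hsub'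
  have hq : ∀ y ∈ Ici (s + 1), HasDerivAt (fun y : ℝ => ((y - s : ℝ) : ℂ) * f y)
      (f y + ((y - s : ℝ) : ℂ) * deriv f y) y := fun y hy => by
    have h2 : HasDerivAt (fun y : ℝ => ((y - s : ℝ) : ℂ)) 1 y :=
      ((hasDerivAt_id y).sub_const s).ofReal_comp
    refine (h2.mul (hf.hasDerivAt (hsub hy))).congr_deriv ?_
    rw [one_mul]
  have hqs : Subexp (s + 1) fun y => f y + ((y - s : ℝ) : ℂ) * deriv f y :=
    Subexp.add (fun c hc => (hs c hc).mono_set hsub') (subexp_of_subexp_deriv hp hpc hps)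
  have h := airyHankel_diff_comm hs (hs.const_mul ν) (fun y hy => hf.hasDerivAt hy)
    (fun y hy => hf.hasDerivAt_sub_mul_deriv hy) hf.boundary
    (tendsto_sub_mul_of_tendsto_sub_mul_deriv (fun y hy => hf.hasDerivAt hy) hf.boundary)
    (tendsto_exp_neg_mul_of_subexp_deriv hp hpc hps)
    (tendsto_exp_neg_mul_of_subexp_deriv hq ((hcont.mono hsub).add fun y hy =>
      (hp y hy).continuousAt.continuousWithinAt) hqs) lam x
  rw [airyHankel_const_mul] at h
  linear_combination -h

theorem exists_airyHankel_eq_mul (hf : IsDiffLEigenfunction s f ν) (lam : ℝ) :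
    ∃ c : ℂ, ∀ x ∈ Ioi s, airyHankel lam s 0 f x = c * f x := by
  have hs := subexp_of_memLp hf.memLp
  have hlin : ∀ y : ℝ, HasDerivAt (fun y : ℝ => ((y - s : ℝ) : ℂ)) 1 y := fun y =>
    ((hasDerivAt_id y).sub_const s).ofReal_comp
  have hg := hasDerivAt_airyHankel hs lam 0
  have hg' : ∀ y, HasDerivAt (fun y : ℝ => ((y - s : ℝ) : ℂ) * airyHankel lam s 1 f y)
      ((ν + ((y * (y - s) : ℝ) : ℂ)) * airyHankel lam s 0 f y) y := fun y => by
    refine ((hlin y).mul (hasDerivAt_airyHankel hs lam 1 y)).congr_deriv ?_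
    rw [← hf.airyHankel_eq lam y]
    ring
  -- The weighted Wronskian of f and Hf. Since it vanishes, Hf - cf has zero Cauchy data at a point
  -- where f ≠ 0, for the c that matches the values there.
  set w : ℝ → ℂ := fun y => f y * (((y - s : ℝ) : ℂ) * airyHankel lam s 1 f y) -
    ((y - s : ℝ) : ℂ) * deriv f y * airyHankel lam s 0 f y with hw
  have hwd : ∀ y ∈ Ioi s, HasDerivAt w 0 y := fun y hy => by
    refine (((hf.hasDerivAt hy).mul (hg' y)).sub
      ((hf.hasDerivAt_sub_mul_deriv hy).mul (hg y))).congr_deriv ?_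
    ring
  have hlim : Tendsto w (𝓝[>] s) (𝓝 0) := by
    have hc : ∀ n, Tendsto (airyHankel lam s n f) (𝓝[>] s) (𝓝 (airyHankel lam s n f s)) :=
      fun n => ((continuous_airyHankel hs lam n).tendsto s).mono_left nhdsWithin_le_nhds
    have h1 := ((tendsto_sub_mul_of_tendsto_sub_mul_deriv (fun y hy => hf.hasDerivAt hy)
      hf.boundary).mul (hc 1)).sub (hf.boundary.mul (hc 0))
    rw [zero_mul, zero_mul, sub_zero] at h1
    refine h1.congr fun y => ?_
    rw [hw]
    ring
  have hw0 : ∀ y ∈ Ioi s, w y = 0 := fun y hy => by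
    refine tendsto_nhds_unique (tendsto_const_nhds.congr' ?_) hlim
    filter_upwards [self_mem_nhdsWithin] with z hz
    exact isOpen_Ioi.is_const_of_deriv_eq_zero isPreconnected_Ioi
      (fun t ht => (hwd t ht).differentiableAt.differentiableWithinAt)
      (fun t ht => (hwd t ht).deriv) hy hz
  obtain ⟨x₀, hx₀, hfx₀⟩ := hf.ne_zero
  set c := airyHankel lam s 0 f x₀ / f x₀ with hc
  have hcf : c * f x₀ = airyHankel lam s 0 f x₀ := div_mul_cancel₀ _ hfx₀
  refine ⟨c, fun x hx => sub_eq_zero.1 ?_⟩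
  have hx₀s : s < x₀ := hx₀
  have hxs : s < x := hx
  have hmin : s < min x₀ x := lt_min hx₀s hxs
  have hm1 := min_le_left x₀ x
  have hm2 := min_le_right x₀ x
  have hM1 := le_max_left x₀ x
  have hM2 := le_max_right x₀ x
  have hpos : ∀ t, (s + min x₀ x) / 2 ≤ t → s < t := fun t ht => by linarith
  refine linear_system_eq_zero (a := (s + min x₀ x) / 2) (b := max x₀ x + 1) (x₀ := x₀)
    (α := fun t => (((t - s)⁻¹ : ℝ) : ℂ)) (β := fun t => ν + ((t * (t - s) : ℝ) : ℂ))
    (u := fun t => airyHankel lam s 0 f t - c * f t)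
    (v := fun t => ((t - s : ℝ) : ℂ) * airyHankel lam s 1 f t -
      c * (((t - s : ℝ) : ℂ) * deriv f t)) ⟨by linarith, by linarith⟩ ?_
    (Continuous.continuousOn (by fun_prop)) (fun t ht => ?_) (fun t ht => ?_) ?_ ?_ x
    ⟨by linarith, by linarith⟩
  · refine Complex.continuous_ofReal.comp_continuousOn (ContinuousOn.inv₀ (by fun_prop) ?_)
    exact fun t ht => (sub_pos.2 (hpos t ht.1)).ne'
  · have hts := hpos t ht.1.le
    refine ((hg t).sub ((hf.hasDerivAt hts).const_mul c)).congr_deriv ?_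
    have h0 : ((t : ℂ) - s) ≠ 0 := by
      rw [← Complex.ofReal_sub]
      exact Complex.ofReal_ne_zero.2 (sub_pos.2 hts).ne'
    push_cast
    field_simp
  · have hts := hpos t ht.1.le
    refine ((hg' t).sub ((hf.hasDerivAt_sub_mul_deriv hts).const_mul c)).congr_deriv ?_
    ring
  · simp only [hcf, sub_self]
  · have h := hw0 x₀ hx₀
    simp only [hw, ← hcf] at h
    refine (mul_eq_zero.1 (?_ : f x₀ * _ = 0)).resolve_left hfx₀
    linear_combination h

theorem exists_isAiryEigenfunction (hf : IsDiffLEigenfunction s f ν) (lam : ℝ) :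
    ∃ κ : ℂ, IsAiryEigenfunction lam s f κ := by
  have hs := subexp_of_memLp hf.memLp
  obtain ⟨c, hc⟩ := hf.exists_airyHankel_eq_mul lam
  refine ⟨c ^ 2, hf.memLp, fun h => ?_, ae_of_all _ (integrableOn_airyKernel_mul hs lam), ?_⟩
  · obtain ⟨x, hx, hfx⟩ := hf.ne_zero
    exact hfx (Measure.eqOn_open_of_ae_eq h isOpen_Ioi hf.contDiffOn.continuousOn
      continuousOn_const hx)
  · filter_upwards [ae_restrict_mem measurableSet_Ioi] with x hx
    rw [integral_airyKernel_mul hs, airyHankel_congr (g := fun y => c * f y)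
      ((ae_restrict_mem measurableSet_Ioi).mono hc), airyHankel_const_mul, hc x hx]
    ring

theorem eigenvalue_eq_of_ae_eq_const_mul {f₁ f₂ : ℝ → ℂ} {ν₁ ν₂ c : ℂ}
    (h₁ : IsDiffLEigenfunction s f₁ ν₁) (h₂ : IsDiffLEigenfunction s f₂ ν₂)
    (h : f₂ =ᵐ[volume.restrict (Ioi s)] fun x => c * f₁ x) : ν₁ = ν₂ := by
  have he : EqOn f₂ (fun x => c * f₁ x) (Ioi s) :=
    Measure.eqOn_open_of_ae_eq h isOpen_Ioi h₂.contDiffOn.continuousOn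
      (continuousOn_const.mul h₁.contDiffOn.continuousOn)
  have hd : ∀ y ∈ Ioi s, deriv f₂ y = c * deriv f₁ y := fun y hy => by
    rw [(he.eventuallyEq_of_mem (isOpen_Ioi.mem_nhds hy)).deriv_eq]
    exact ((h₁.hasDerivAt hy).const_mul c).deriv
  -- At a point where f₂ ≠ 0, the two expressions for ((x - s)f₂')' determine the eigenvalue.
  obtain ⟨x, hx, hfx⟩ := h₂.ne_zero
  have hp : (fun y : ℝ => ((y - s : ℝ) : ℂ) * deriv f₂ y) =ᶠ[𝓝 x]
      fun y => c * (((y - s : ℝ) : ℂ) * deriv f₁ y) := by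
    filter_upwards [isOpen_Ioi.mem_nhds hx] with y hy
    rw [hd y hy]
    ring
  have h3 := (h₂.hasDerivAt_sub_mul_deriv hx).unique
    (((h₁.hasDerivAt_sub_mul_deriv hx).const_mul c).congr_of_eventuallyEq hp)
  have h4 : f₂ x = c * f₁ x := he hx
  refine mul_right_cancel₀ hfx ?_
  linear_combination -h3 + (ν₁ + ((x * (x - s) : ℝ) : ℂ)) * h4

end IsDiffLEigenfunction

theorem lemma1 (lam : ℝ) (hlam : 0 < lam) (s : ℝ) :
    (∀ (f₁ f₂ : ℝ → ℂ) (ν₁ ν₂ : ℂ),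
      IsDiffLEigenfunction s f₁ ν₁ → IsDiffLEigenfunction s f₂ ν₂ → ν₁ ≠ ν₂ →
        ∃ κ₁ κ₂ : ℂ, IsAiryEigenfunction lam s f₁ κ₁ ∧ IsAiryEigenfunction lam s f₂ κ₂ ∧
          κ₁ ≠ κ₂) ∧
    (∀ κ : ℂ, IsAiryEigenvalue lam s κ → IsSimpleAiryEigenvalue lam s κ) := by
  refine ⟨fun f₁ f₂ ν₁ ν₂ h₁ h₂ hν => ?_, fun κ hκ => hκ.isSimple hlam⟩
  obtain ⟨κ₁, hκ₁⟩ := h₁.exists_isAiryEigenfunction lam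
  obtain ⟨κ₂, hκ₂⟩ := h₂.exists_isAiryEigenfunction lam
  refine ⟨κ₁, κ₂, hκ₁, hκ₂, ?_⟩
  -- A common eigenvalue of K is simple, so f₂ is a multiple of f₁, which contradicts ν₁ ≠ ν₂.
  rintro rfl
  obtain ⟨f, -, hf⟩ := IsAiryEigenvalue.isSimple hlam ⟨f₁, hκ₁⟩
  obtain ⟨c₁, hc₁⟩ := hf f₁ hκ₁
  obtain ⟨c₂, hc₂⟩ := hf f₂ hκ₂
  have hc₁0 : c₁ ≠ 0 := by
    rintro rfl
    exact hκ₁.ne_zero (hc₁.trans (ae_of_all _ fun x => zero_mul _))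
  refine hν (h₁.eigenvalue_eq_of_ae_eq_const_mul h₂ (c := c₂ / c₁) ?_)
  filter_upwards [hc₁, hc₂] with x hx₁ hx₂
  rw [hx₁, hx₂]
  field_simp

end
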